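/- Let $N\ge 2$ be an integer, $r>0$, $0<t_*<\infty$, $\beta>0$. For $v\in\mathbb C$, $\operatorname{Im}\tau>0$ put $$\vartheta_1(v;\tau)=i\sum_{n\in\mathbb Z}(-1)^n e^{\pi i\tau(n-1/2)^2}e^{\pi i v(2n-1)},$$ and for $t\in[0,t_*)$ let $\tau(t)=\frac{i(t_*-t)}{2\pi r^2}$ and $$U_N(t,x)=-\log\left|\vartheta_1\!\left(\tfrac{x}{2\pi r};N\tau(t)\right)\right|,\qquad x\in\mathbb R\setminus 2\pi r\mathbb Z$$ ($\vartheta_1$ is real here, and positive for $0<x<2\pi r$); $U_N'$, $U_N''$ are the first two $x$-derivatives. For $x=(x_1,\dots,x_N)\in\mathbb R^N$ let $$\overline x=\sum_{j=1}^N x_j-\kappa_N,\quad \kappa_N=\frac{\pi r}{2}\bigl(2N-3+(-1)^N\bigr),\quad W_N(t,x)=\sum_{1\le j<k\le N}U_N(t,x_k-x_j)+U_N(t,\overline x),$$ and let $R_N$ be the set of $x\in\mathbb R^N$ with $\overline x\notin 2\pi r\mathbb Z$ and $x_k-x_j\notin 2\pi r\mathbb Z$ for all $j<k$; it contains all $x$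 with $x_1<\dots<x_N<x_1+2\pi r$ and $0<\overline x<2\pi r$. Let $$\mathcal L_N^{(\beta)}(t)f=\frac12\sum_{j=1}^N\frac{\partial^2 f}{\partial x_j^2}+\frac\beta2\sum_{j=1}^N\frac{\partial}{\partial x_j}\left(\frac{\partial W_N}{\partial x_j}f\right).$$ Let $\zeta$ and $\wp$ be the Weierstrass functions with (full) periods $2\pi r$ and $2N\omega_3(t)=iN(t_*-t)/r$, that is, with lattice $\Lambda=2\pi r\mathbb Z+\frac{iN(t_*-t)}{r}\mathbb Z$, $$\zeta(z)=\frac1z+\sum_{\Omega\in\Lambda\setminus\{0\}}\left[\frac1{z-\Omega}+\frac1\Omega+\frac z{\Omega^2}\right],\qquad \wp(z)=\frac1{z^2}+\sum_{\Omega\in\Lambda\setminus\{0\}}\left[\frac1{(z-\Omega)^2}-\frac1{\Omega^2}\right],$$ and $\eta_1=\zeta(\pi r)$ (these depend on $t$; $\eta_1$ is real). Put $$V_N^{(\beta)}(t,x)=\frac{\beta(\beta-2)}8N\left[\sum_{j<k}U_N'(t,x_k-x_j)^2+U_N'(t,\overline x)^2-\frac{N-2}N\sum_{j<k}U_N''(t,x_k-x_j)\right],$$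 $$E_{N,0}^{(\beta)}(t)=-\frac{\beta^2}{16}N(N-1)(N-2)\frac{1}{\pi r}\eta_1,\qquad \mathcal H_N^{(\beta)}(t)=-\frac12\sum_{j=1}^N\frac{\partial^2}{\partial x_j^2}+V_N^{(\beta)}(t,x).$$ Then, for $t\in[0,t_*)$ and $x\in R_N$: (i) as an identity of operators on functions of $(t,x)$ that are differentiable in $t$ (one-sidedly at $t=0$) and $C^2$ in $x$ (it holds at every point near which the function has this regularity), $$e^{\beta W_N/2}\left[\frac{\partial}{\partial t}-\mathcal L_N^{(\beta)}(t)\right]e^{-\beta W_N/2}=\frac{\partial}{\partial t}+\left(\mathcal H_N^{(\beta)}(t)-E_{N,0}^{(\beta)}(t)\right);$$ (ii) $$V_N^{(\beta)}(t,x)=\frac{\beta(\beta-2)}8N\left[\sum_{j<k}\left(\zeta(x_k-x_j)-\frac{x_k-x_j}{\pi r}\eta_1\right)^2+\left(\zeta(\overline x)-\frac{\overline x}{\pi r}\eta_1\right)^2-\frac{N-2}N\sum_{j<k}\left(\wp(x_k-x_j)+\frac{\eta_1}{\pi r}\right)\right].$$ -/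

import Mathlib

noncomputable section

open Complex in
/-- The Jacobi theta function
`ϑ₁(v; τ) = i ∑_{n ∈ ℤ} (-1)^n q^{(n - 1/2)²} z^{2n - 1}`, with `z = e^{π i v}`, `q = e^{π i τ}`
(absolutely convergent for `Im τ > 0`). -/
def jacobiThetaOne (v τ : ℂ) : ℂ :=
  I * ∑' n : ℤ, (-1) ^ n * exp (Real.pi * I * τ * ((n : ℂ) - 1 / 2) ^ 2)
    * exp (Real.pi * I * v * (2 * (n : ℂ) - 1))

open Complex in
/-- `ϑ₁` is real for real `v` and purely imaginary `τ`. -/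
theorem jacobiThetaOne_conj (v s : ℝ) :
    (starRingEnd ℂ) (jacobiThetaOne v (I * s)) = jacobiThetaOne v (I * s) := by
  unfold jacobiThetaOne
  rw [map_mul, conj_I, conj_tsum, ← (Equiv.subLeft (1 : ℤ)).tsum_eq, neg_mul, ← mul_neg,
    ← tsum_neg]
  congr 2
  funext n
  simp only [Equiv.subLeft_apply, map_mul, ← exp_conj, map_zpow₀, map_neg, map_one, map_pow,
    map_sub, map_div₀, map_ofNat, conj_I, conj_ofReal]
  have h1 : ((-1 : ℂ)) ^ (1 - n) = -(-1) ^ n := by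
    rw [zpow_sub₀ (by norm_num), zpow_one]
    rcases Int.even_or_odd n with h | h
    · simp [h.neg_one_zpow]
    · simp [h.neg_one_zpow]
  have h2 : ∀ m : ℤ, (starRingEnd ℂ) (m : ℂ) = m := fun m => by
    simp
  rw [h1, h2]
  push_cast
  rw [neg_mul, neg_mul, neg_neg]
  have h3 : (Real.pi : ℂ) * -I * (-I * s) * (1 - (n : ℂ) - 1 / 2) ^ 2
      = Real.pi * I * (I * s) * ((n : ℂ) - 1 / 2) ^ 2 := by ring
  have h4 : (Real.pi : ℂ) * -I * v * (2 * (1 - (n : ℂ)) - 1)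
      = Real.pi * I * v * (2 * (n : ℂ) - 1) := by ring
  rw [h3, h4]

/-- `U_N(t, x) = -log ϑ₁(x / (2πr); N τ(t))` with `τ(t) = i (T - t) / (2πr²)`.
For these arguments `ϑ₁` takes real values, so `.re` only changes the type. It is positive
on `(0, 2πr)`; as `Real.log` is `log |·|`, the value elsewhere is `-log |ϑ₁|`. -/
def thetaPotential (N : ℕ) (r T t x : ℝ) : ℝ :=
  -Real.log (jacobiThetaOne (x / (2 * Real.pi * r) : ℝ)
    (Complex.I * (N * (T - t) / (2 * Real.pi * r ^ 2) : ℝ))).re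

/-- `U_N'(t, x)`. -/
def thetaPotential' (N : ℕ) (r T t x : ℝ) : ℝ :=
  deriv (fun y => thetaPotential N r T t y) x

/-- `U_N''(t, x)`. -/
def thetaPotential'' (N : ℕ) (r T t x : ℝ) : ℝ :=
  deriv (fun y => thetaPotential' N r T t y) x

/-- `κ_N = (πr/2) (2N - 3 + (-1)^N)`. -/
def kappaShift (N : ℕ) (r : ℝ) : ℝ :=
  Real.pi * r / 2 * (2 * N - 3 + (-1) ^ N)

/-- The shifted center of mass `x̄ = x_1 + ⋯ + x_N - κ_N`. -/
def shiftedSum {N : ℕ} (r : ℝ) (x : Fin N → ℝ) : ℝ :=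
  ∑ j, x j - kappaShift N r

/-- `W_N(t, x) = ∑_{j < k} U_N(t, x_k - x_j) + U_N(t, x̄)`. -/
def dysonPotential {N : ℕ} (r T t : ℝ) (x : Fin N → ℝ) : ℝ :=
  ∑ j, ∑ k ∈ Finset.Ioi j, thetaPotential N r T t (x k - x j)
    + thetaPotential N r T t (shiftedSum r x)

/-- The configurations at which no term of `W_N` is singular. They contain
the alcove `x_1 < ⋯ < x_N < x_1 + 2πr`, `0 < x̄ < 2πr`. -/
def regularConfigurations (N : ℕ) (r : ℝ) : Set (Fin N → ℝ) :=
  {x | (∀ j k, j < k → ∀ m : ℤ, x k - x j ≠ 2 * Real.pi * r * m) ∧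
    ∀ m : ℤ, shiftedSum r x ≠ 2 * Real.pi * r * m}

/-- The partial derivative `∂f/∂x_j`. -/
def coordDeriv {N : ℕ} (j : Fin N) (f : (Fin N → ℝ) → ℝ) (x : Fin N → ℝ) : ℝ :=
  deriv (fun s => f (Function.update x j s)) (x j)

/-- The time derivative `∂f/∂t` on the time interval `[0, T)` (one-sided at `0`). -/
def timeDeriv {N : ℕ} (T : ℝ) (f : ℝ → (Fin N → ℝ) → ℝ) (t : ℝ) (x : Fin N → ℝ) : ℝ :=
  derivWithin (fun s => f s x) (Set.Ico 0 T) t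

/-- The Kolmogorov operator
`L f = (1/2) ∑_j ∂²f/∂x_j² + (β/2) ∑_j ∂/∂x_j ((∂W_N/∂x_j) f)`. -/
def kolmogorovOp {N : ℕ} (β r T t : ℝ) (f : (Fin N → ℝ) → ℝ) (x : Fin N → ℝ) : ℝ :=
  1 / 2 * ∑ j, coordDeriv j (coordDeriv j f) x
    + β / 2 * ∑ j, coordDeriv j (fun y => coordDeriv j (dysonPotential r T t) y * f y) x

/-- The interaction `V_N^{(β)}(t, x)`, in terms of `U_N'` and `U_N''`. -/
def interaction {N : ℕ} (β r T t : ℝ) (x : Fin N → ℝ) : ℝ :=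
  β * (β - 2) / 8 * N *
    (∑ j, ∑ k ∈ Finset.Ioi j, thetaPotential' N r T t (x k - x j) ^ 2
      + thetaPotential' N r T t (shiftedSum r x) ^ 2
      - ((N : ℝ) - 2) / N
        * ∑ j, ∑ k ∈ Finset.Ioi j, thetaPotential'' N r T t (x k - x j))

/-- The Hamiltonian `H f = -(1/2) ∑_j ∂²f/∂x_j² + V_N^{(β)} f`. -/
def hamiltonianOp {N : ℕ} (β r T t : ℝ) (f : (Fin N → ℝ) → ℝ) (x : Fin N → ℝ) : ℝ :=
  -(1 / 2) * ∑ j, coordDeriv j (coordDeriv j f) x + interaction β r T t x * f x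

/-- The Weierstrass zeta function of the lattice `Λ = ℤ ω₁ + ℤ ω₂`:
`ζ(z) = 1/z + ∑_{l ∈ Λ ∖ {0}} (1/(z - l) + 1/l + z/l²)`.
As `1 / 0 = 0`, the term `l = 0` of the sum below is `1/z`. -/
def PeriodPair.weierstrassZeta (L : PeriodPair) (z : ℂ) : ℂ :=
  ∑' l : L.lattice, (1 / (z - l) + 1 / (l : ℂ) + z / (l : ℂ) ^ 2)

/-- `η₁ = ζ(ω₁/2)`, the value of `ζ` at half of the first (full) period. -/
def PeriodPair.etaOne (L : PeriodPair) : ℂ := L.weierstrassZeta (L.ω₁ / 2)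

/-- The pair of (full) periods `2ω₁ = 2πr` and `2Nω₃(t) = i N (T - t) / r`. -/
def dysonPeriods {N : ℕ} {r T t : ℝ} (hN : 2 ≤ N) (hr : 0 < r) (ht : t < T) : PeriodPair where
  ω₁ := (2 * Real.pi * r : ℝ)
  ω₂ := Complex.I * (N * (T - t) / r : ℝ)
  indep := by
    rw [LinearIndependent.pair_iff]
    intro a b h
    have hN' : (0 : ℝ) < N := by exact_mod_cast (by omega : 0 < N)
    have h1 : 2 * Real.pi * r ≠ 0 := by positivity
    have h2 : N * (T - t) / r ≠ 0 := by
      have : 0 < T - t := sub_pos.2 ht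
      positivity
    have hre := congrArg Complex.re h
    have him := congrArg Complex.im h
    simp only [Complex.real_smul, Complex.add_re, Complex.add_im, Complex.re_ofReal_mul,
      Complex.im_ofReal_mul, Complex.ofReal_re, Complex.ofReal_im, Complex.I_mul_re,
      Complex.I_mul_im, Complex.zero_re, Complex.zero_im, neg_zero, mul_zero, add_zero,
      zero_add] at hre him
    exact ⟨(mul_eq_zero.1 hre).resolve_right h1, (mul_eq_zero.1 him).resolve_right h2⟩

/-- `η₁` is real for these periods. -/
theorem etaOne_dysonPeriods_conj {N : ℕ} {r T t : ℝ} (hN : 2 ≤ N) (hr : 0 < r) (ht : t < T) :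
    (starRingEnd ℂ) (dysonPeriods hN hr ht).etaOne = (dysonPeriods hN hr ht).etaOne := by
  have h1 : (starRingEnd ℂ) (dysonPeriods hN hr ht).ω₁ = (dysonPeriods hN hr ht).ω₁ :=
    Complex.conj_ofReal _
  have h2 : (starRingEnd ℂ) (dysonPeriods hN hr ht).ω₂ = -(dysonPeriods hN hr ht).ω₂ := by
    simp only [dysonPeriods, map_mul, Complex.conj_I, Complex.conj_ofReal, neg_mul]
  generalize dysonPeriods hN hr ht = L at h1 h2
  unfold PeriodPair.etaOne PeriodPair.weierstrassZeta
  rw [Complex.conj_tsum, ← L.latticeEquivProd.symm.toEquiv.tsum_eq,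
    ← ((Equiv.refl ℤ).prodCongr (Equiv.neg ℤ)).tsum_eq,
    ← L.latticeEquivProd.symm.toEquiv.tsum_eq (fun l : L.lattice =>
      1 / (L.ω₁ / 2 - (l : ℂ)) + 1 / (l : ℂ) + L.ω₁ / 2 / (l : ℂ) ^ 2)]
  congr 1
  funext p
  have h3 : ((L.latticeEquivProd.symm.toEquiv p : L.lattice) : ℂ) = p.1 * L.ω₁ + p.2 * L.ω₂ :=
    L.latticeEquiv_symm_apply p
  have h4 : (starRingEnd ℂ) ((L.latticeEquivProd.symm.toEquiv
      (((Equiv.refl ℤ).prodCongr (Equiv.neg ℤ)) p) : L.lattice) : ℂ)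
      = p.1 * L.ω₁ + p.2 * L.ω₂ := by
    rw [show ((L.latticeEquivProd.symm.toEquiv
      (((Equiv.refl ℤ).prodCongr (Equiv.neg ℤ)) p) : L.lattice) : ℂ)
        = (p.1 : ℂ) * L.ω₁ + ((-p.2 : ℤ) : ℂ) * L.ω₂ from L.latticeEquiv_symm_apply _]
    simp [h1, h2]
  simp only [map_add, map_sub, map_div₀, map_one, map_pow, map_ofNat, h1, h3, h4]

/-- The ground energy `E_{N,0}^{(β)}(t) = -(β²/16) N (N-1) (N-2) η₁ / (πr)`
(`η₁` is real, so `.re` only changes the type). -/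
def groundEnergy {N : ℕ} {r T t : ℝ} (β : ℝ) (hN : 2 ≤ N) (hr : 0 < r) (ht : t < T) : ℝ :=
  -(β ^ 2 / 16) * N * ((N : ℝ) - 1) * ((N : ℝ) - 2) * (1 / (Real.pi * r))
    * (dysonPeriods hN hr ht).etaOne.re

end

/-!
Let `ϑ(z) = ϑ₁(z / ω₁; ω₂ / ω₁)` and `ζ̂(z) = ζ(z) - (2 η₁ / ω₁) z`, which is odd and has period
`ω₁`. For a suitable constant `k` the function `ϑ ζ̂ - k ϑ'` is entire with the quasi-periodicity of
`ϑ`, hence a multiple of `ϑ`; being even, it vanishes, and the residue of `ζ̂` at the origin gives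
`k = 1`. Hence `U_N' = -ζ̂` and `U_N'' = ℘ + 2 η₁ / ω₁`, and the heat equation for `ϑ₁` gives
`∂U_N/∂t = (N/2) (U_N'² - U_N'')`.

Conjugation by `e^{βW/2}` turns `∂/∂t - L` into `∂/∂t - (1/2) Δ` plus multiplication by
`(β²/8) |∇W|² - (β/4) ΔW - (β/2) ∂W/∂t`. The products of different `U_N'` in `|∇W|²` are removed by
the addition theorem `(ζ̂(a) + ζ̂(b) - ζ̂(a + b))² = ℘(a) + ℘(b) + ℘(a + b)`, applied to the triples
`x_j - x_k`, `x_k - x_l`; those involving `x̄` cancel because `U_N'` is odd.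
-/

noncomputable section

open Filter Topology Complex

section RemovableSingularities

lemma exists_differentiable_eventuallyEq_nhdsNE {f : ℂ → ℂ} (hf : Meromorphic f)
    (h : ∀ a, 0 ≤ meromorphicOrderAt f a) :
    ∃ F : ℂ → ℂ, Differentiable ℂ F ∧ ∀ a, f =ᶠ[𝓝[≠] a] F := by
  have hU : MeromorphicOn f Set.univ := hf.meromorphicOn
  have hF (a : ℂ) : toMeromorphicNFOn f Set.univ =ᶠ[𝓝[≠] a] f :=
    hU.toMeromorphicNFOn_eq_self_on_nhdsNE (Set.mem_univ a)
  refine ⟨toMeromorphicNFOn f Set.univ, fun a ↦ ?_, fun a ↦ (hF a).symm⟩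
  refine AnalyticAt.differentiableAt ?_
  rw [← (meromorphicNFOn_toMeromorphicNFOn f Set.univ
    (Set.mem_univ a)).meromorphicOrderAt_nonneg_iff_analyticAt, meromorphicOrderAt_congr (hF a)]
  exact h a

lemma eq_mul_of_eventuallyEq_nhdsNE {f F m : ℂ → ℂ} {l : ℂ} (hF : Continuous F)
    (hm : Continuous m) (hfF : ∀ a, f =ᶠ[𝓝[≠] a] F)
    (hf : ∀ a, ∀ᶠ z in 𝓝[≠] a, f (z + l) = m z * f z) (z : ℂ) : F (z + l) = m z * F z := by
  have h : (fun z ↦ F (z + l)) =ᶠ[𝓝[≠] z] fun z ↦ m z * F z := by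
    have htrans : Tendsto (· + l) (𝓝[≠] z) (𝓝[≠] (z + l)) :=
      ((hasDerivAt_id z).add_const l).tendsto_nhdsNE one_ne_zero
    filter_upwards [htrans.eventually (hfF (z + l)), hfF z, hf z] with w h₁ h₂ h₃
    rw [← h₁, ← h₂, h₃]
  exact ((ContinuousAt.eventuallyEq_nhds_iff_eventuallyEq_nhdsNE (by fun_prop) (by fun_prop)).1
    h).eq_of_nhds

lemma eventually_notMem_lattice (L : PeriodPair) (a : ℂ) : ∀ᶠ z in 𝓝[≠] a, z ∉ L.lattice := by
  filter_upwards [self_mem_nhdsWithin, mem_nhdsWithin_of_mem_nhds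
    (L.compl_lattice_sdiff_singleton_mem_nhds a)] with z hz hz' h
  exact hz' ⟨h, hz⟩

lemma exists_eventuallyEq_const_of_periodic (L : PeriodPair) {f : ℂ → ℂ} (hf : Meromorphic f)
    (h : ∀ a, 0 ≤ meromorphicOrderAt f a)
    (hper : ∀ l ∈ L.lattice, ∀ a, ∀ᶠ z in 𝓝[≠] a, f (z + l) = f z) :
    ∃ c : ℂ, ∀ a, f =ᶠ[𝓝[≠] a] fun _ ↦ c := by
  obtain ⟨F, hF, hfF⟩ := exists_differentiable_eventuallyEq_nhdsNE hf h
  have hFper (z l : ℂ) (hl : l ∈ L.lattice) : F (z + l) = F z := by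
    simpa using eq_mul_of_eventuallyEq_nhdsNE (m := 1) hF.continuous continuous_one hfF
      (by simpa using hper l hl) z
  have hbdd := (IsZLattice.isCompact_range_of_periodic L.lattice _ hF.continuous hFper).isBounded
  exact ⟨F 0, fun a ↦ (hfF a).trans (.of_forall fun z ↦ hF.apply_eq_apply_of_bounded hbdd z 0)⟩

end RemovableSingularities

section WeierstrassZeta

variable (L : PeriodPair)

/-- The regular part `ζ(z) - 1/z` of the Weierstrass zeta function at the origin; as for
Mathlib's `weierstrassPExcept`, the term `l = 0` is left out of the sum. -/
def weierstrassZetaRegular (z : ℂ) : ℂ :=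
  ∑' l : L.lattice, if l.1 = 0 then 0 else (1 / (z - l) + 1 / (l : ℂ) + z / (l : ℂ) ^ 2)

lemma norm_weierstrassZeta_term_le {R : ℝ} {z l : ℂ} (hz : ‖z‖ < R) (hl : 2 * R ≤ ‖l‖) :
    ‖1 / (z - l) + 1 / l + z / l ^ 2‖ ≤ 2 * R ^ 2 * ‖l‖ ^ (-3 : ℝ) := by
  have hl_pos : 0 < ‖l‖ := by linarith [norm_nonneg z]
  have hl_ne : l ≠ 0 := norm_pos_iff.1 hl_pos
  have hzl : ‖l‖ / 2 ≤ ‖z - l‖ := by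
    rw [norm_sub_rev]
    linarith [norm_sub_norm_le l z]
  have hzl_ne : z - l ≠ 0 := norm_pos_iff.1 (by linarith)
  calc ‖1 / (z - l) + 1 / l + z / l ^ 2‖ = ‖z‖ ^ 2 / (‖z - l‖ * ‖l‖ ^ 2) := by
        rw [← norm_pow, ← norm_pow, ← norm_mul, ← norm_div]
        congr 1
        field
    _ ≤ R ^ 2 / (‖l‖ / 2 * ‖l‖ ^ 2) := by gcongr
    _ = 2 * R ^ 2 / ‖l‖ ^ 3 := by field
    _ = 2 * R ^ 2 * ‖l‖ ^ (-3 : ℝ) := by norm_cast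

lemma hasSum_weierstrassZetaRegular (z : ℂ) :
    HasSum (fun l : L.lattice ↦
      if l.1 = 0 then 0 else (1 / (z - l) + 1 / (l : ℂ) + z / (l : ℂ) ^ 2))
      (weierstrassZetaRegular L z) := by
  refine (L.hasSumLocallyUniformly_aux (u := fun R l ↦ 2 * R ^ 2 * ‖l‖ ^ (-3 : ℝ))
    (fun l z ↦ if l.1 = 0 then 0 else (1 / (z - l) + 1 / (l : ℂ) + z / (l : ℂ) ^ 2))
    (fun _ _ ↦ (ZLattice.summable_norm_rpow _ _ (by simp; norm_num)).mul_left _) fun R hR ↦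
    eventually_atTop.mpr ⟨2 * R, ?_⟩).hasSum
  rintro _ hl z hz l rfl
  split_ifs
  · rw [norm_zero]
    positivity
  · exact norm_weierstrassZeta_term_le hz hl

lemma weierstrassZeta_eq (z : ℂ) : L.weierstrassZeta z = 1 / z + weierstrassZetaRegular L z := by
  rw [PeriodPair.weierstrassZeta,
    ← ((hasSum_ite_eq (0 : L.lattice) (1 / z)).add (hasSum_weierstrassZetaRegular L z)).tsum_eq]
  congr with l
  by_cases hl : l = 0 <;> simp [hl]

lemma hasDerivAt_weierstrassZetaRegular {z : ℂ} (hz : z ∈ ((L.lattice : Set ℂ) \ {0})ᶜ) :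
    HasDerivAt (weierstrassZetaRegular L) (-L.weierstrassPExcept 0 z) z := by
  refine hasDerivAt_of_tendstoLocallyUniformlyOn (L.isOpen_compl_lattice_sdiff (s := {0}))
    (L.hasSumLocallyUniformly_weierstrassPExcept 0).neg.tendstoLocallyUniformlyOn ?_
    (fun w _ ↦ hasSum_weierstrassZetaRegular L w) hz
  refine .of_forall fun s w hw ↦ ?_
  simp only [Pi.neg_apply, ← Finset.sum_neg_distrib]
  refine .fun_sum fun l _ ↦ ?_
  split_ifs with hl
  · simpa using hasDerivAt_const w (0 : ℂ)
  · have hwl : w - l ≠ 0 := fun h ↦ hw (by simpa [sub_eq_zero.1 h] using hl)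
    refine (((((hasDerivAt_const w (1 : ℂ)).fun_div ((hasDerivAt_id' w).sub_const _) hwl).add_const
      _).fun_add ((hasDerivAt_id' w).div_const _))).congr_deriv ?_
    ring

lemma hasDerivAt_weierstrassZeta {z : ℂ} (hz : z ∉ L.lattice) :
    HasDerivAt L.weierstrassZeta (-L.weierstrassP z) z := by
  have hz₀ : z ≠ 0 := fun h ↦ hz (h ▸ zero_mem _)
  rw [funext (weierstrassZeta_eq L)]
  refine ((hasDerivAt_inv hz₀).add (hasDerivAt_weierstrassZetaRegular L (z := z)
    fun h ↦ hz h.1)).congr_of_eventuallyEq (.of_forall fun w ↦ by simp) |>.congr_deriv ?_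
  rw [← L.weierstrassPExcept_add 0 z]
  simp

lemma weierstrassZeta_neg (z : ℂ) : L.weierstrassZeta (-z) = -L.weierstrassZeta z := by
  simp only [PeriodPair.weierstrassZeta]
  rw [← (Equiv.neg L.lattice).tsum_eq, ← tsum_neg]
  congr with l
  simp only [Equiv.neg_apply, NegMemClass.coe_neg]
  rw [show -z - -(l : ℂ) = -(z - l) by ring, div_neg, div_neg]
  ring

lemma weierstrassZetaRegular_zero : weierstrassZetaRegular L 0 = 0 := by
  have h := weierstrassZeta_eq L 0
  have h' := weierstrassZeta_neg L 0
  rw [neg_zero, CharZero.eq_neg_self_iff] at h'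
  simpa [h'] using h.symm

lemma exists_weierstrassZeta_add {l : ℂ} (hl : l ∈ L.lattice) :
    ∃ c : ℂ, ∀ z ∉ L.lattice, L.weierstrassZeta (z + l) = L.weierstrassZeta z + c := by
  have hd (z : ℂ) (hz : z ∈ (L.lattice : Set ℂ)ᶜ) :
      HasDerivAt (fun z ↦ L.weierstrassZeta (z + l) - L.weierstrassZeta z) 0 z := by
    have hzl : z + l ∉ L.lattice := fun h ↦ hz (by simpa using sub_mem h hl)
    refine (((hasDerivAt_weierstrassZeta L hzl).comp_add_const z l).sub
      (hasDerivAt_weierstrassZeta L hz)).congr_deriv ?_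
    rw [L.weierstrassP_add_coe z ⟨l, hl⟩, sub_self]
  have hconn : IsPreconnected (L.lattice : Set ℂ)ᶜ :=
    (Set.Countable.isConnected_compl_of_one_lt_rank (by simp)
      (Set.countable_coe_iff.1 (inferInstanceAs (Countable L.lattice)))).2
  obtain ⟨c, hc⟩ := L.isClosed_lattice.isOpen_compl.exists_is_const_of_deriv_eq_zero hconn
    (fun z hz ↦ (hd z hz).differentiableAt.differentiableWithinAt) (fun z hz ↦ (hd z hz).deriv)
  exact ⟨c, fun z hz ↦ by linear_combination hc z hz⟩

lemma weierstrassZeta_add_ω₁ {z : ℂ} (hz : z ∉ L.lattice) :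
    L.weierstrassZeta (z + L.ω₁) = L.weierstrassZeta z + 2 * L.etaOne := by
  obtain ⟨c, hc⟩ := exists_weierstrassZeta_add L L.ω₁_mem_lattice
  have hhalf := hc (-(L.ω₁ / 2)) fun h ↦ L.ω₁_div_two_notMem_lattice (by simpa using neg_mem h)
  rw [show -(L.ω₁ / 2) + L.ω₁ = L.ω₁ / 2 by ring, weierstrassZeta_neg] at hhalf
  rw [hc z hz, PeriodPair.etaOne]
  linear_combination -hhalf

lemma analyticAt_weierstrassZeta {z : ℂ} (hz : z ∉ L.lattice) :
    AnalyticAt ℂ L.weierstrassZeta z :=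
  DifferentiableOn.analyticAt (s := (L.lattice : Set ℂ)ᶜ) (fun _ hw ↦
    (hasDerivAt_weierstrassZeta L hw).differentiableAt.differentiableWithinAt)
    (L.isClosed_lattice.isOpen_compl.mem_nhds hz)

lemma meromorphicOrderAt_weierstrassZeta_zero :
    meromorphicOrderAt L.weierstrassZeta 0 = -1 := by
  have hreg : AnalyticAt ℂ (weierstrassZetaRegular L) 0 :=
    DifferentiableOn.analyticAt (s := ((L.lattice : Set ℂ) \ {0})ᶜ) (fun w hw ↦
      (hasDerivAt_weierstrassZetaRegular L hw).differentiableAt.differentiableWithinAt)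
      (L.isOpen_compl_lattice_sdiff.mem_nhds (by simp))
  have hpole : meromorphicOrderAt (id⁻¹ : ℂ → ℂ) 0 = -1 := by
    rw [meromorphicOrderAt_inv, meromorphicOrderAt_id]
  have h : L.weierstrassZeta = id⁻¹ + weierstrassZetaRegular L := by
    ext z
    simp [weierstrassZeta_eq]
  rw [h, meromorphicOrderAt_add_eq_left_of_lt hreg.meromorphicAt, hpole]
  rw [hpole]
  exact lt_of_lt_of_le (by decide) hreg.meromorphicOrderAt_nonneg

lemma meromorphicOrderAt_weierstrassZeta {l : ℂ} (hl : l ∈ L.lattice) :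
    meromorphicOrderAt L.weierstrassZeta l = -1 := by
  obtain ⟨c, hc⟩ := exists_weierstrassZeta_add L hl
  have h : (fun z ↦ L.weierstrassZeta (z + l)) =ᶠ[𝓝[≠] 0] L.weierstrassZeta + fun _ ↦ c := by
    filter_upwards [eventually_notMem_lattice L 0] with z hz using hc z hz
  have h0 := meromorphicOrderAt_weierstrassZeta_zero L
  rw [← zero_add l, ← meromorphicOrderAt_fun_comp_add_const_eq_meromorphicOrderAt,
    meromorphicOrderAt_congr h, meromorphicOrderAt_add_eq_left_of_lt (by fun_prop), h0]
  rw [h0]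
  exact lt_of_lt_of_le (by decide) analyticAt_const.meromorphicOrderAt_nonneg

lemma meromorphic_weierstrassZeta : Meromorphic L.weierstrassZeta := by
  intro a
  by_cases ha : a ∈ L.lattice
  · refine meromorphicAt_of_meromorphicOrderAt_ne_zero ?_
    rw [meromorphicOrderAt_weierstrassZeta L ha]
    decide
  · exact (analyticAt_weierstrassZeta L ha).meromorphicAt

end WeierstrassZeta

section AdditionTheorem

variable (L : PeriodPair)

/-- The difference of the two sides of the addition theorem for the Weierstrass zeta function, as a
function of one of the two arguments. -/
def zetaAdditionDefect (b z : ℂ) : ℂ :=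
  (L.weierstrassZeta z + L.weierstrassZeta b - L.weierstrassZeta (z + b)) ^ 2
    - (L.weierstrassP z + L.weierstrassP b + L.weierstrassP (z + b))

lemma analyticAt_zetaAdditionDefect {b z : ℂ} (hz : z ∉ L.lattice) (hzb : z + b ∉ L.lattice) :
    AnalyticAt ℂ (zetaAdditionDefect L b) z := by
  have hζ := analyticAt_weierstrassZeta L hz
  have hP := L.analyticOnNhd_weierstrassP z hz
  have hζb : AnalyticAt ℂ (fun w ↦ L.weierstrassZeta (w + b)) z :=
    (analyticAt_weierstrassZeta L hzb).comp_of_eq (f := fun w ↦ w + b) (by fun_prop) rfl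
  have hPb : AnalyticAt ℂ (fun w ↦ L.weierstrassP (w + b)) z :=
    (L.analyticOnNhd_weierstrassP _ hzb).comp_of_eq (f := fun w ↦ w + b) (by fun_prop) rfl
  unfold zetaAdditionDefect
  fun_prop

lemma meromorphic_zetaAdditionDefect (b : ℂ) : Meromorphic (zetaAdditionDefect L b) := by
  intro z
  have hζ := meromorphic_weierstrassZeta L z
  have hP := L.meromorphic_weierstrassP z
  have hζb := meromorphicAt_comp_add_const_iff_meromorphicAt.2
    (meromorphic_weierstrassZeta L (z + b))
  have hPb := meromorphicAt_comp_add_const_iff_meromorphicAt.2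
    (L.meromorphic_weierstrassP (z + b))
  exact ((hζ.fun_add (.const _ z)).fun_sub hζb).fun_pow 2 |>.fun_sub
    ((hP.fun_add (.const _ z)).fun_add hPb)

lemma zetaAdditionDefect_neg_sub (b z : ℂ) :
    zetaAdditionDefect L b (-b - z) = zetaAdditionDefect L b z := by
  have hz : -b - z + b = -z := by ring
  have hzb : -b - z = -(z + b) := by ring
  rw [zetaAdditionDefect, hz, hzb]
  simp only [zetaAdditionDefect, weierstrassZeta_neg, L.weierstrassP_neg]
  ring

lemma zetaAdditionDefect_add_eventually {l : ℂ} (hl : l ∈ L.lattice) (b a : ℂ) :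
    ∀ᶠ z in 𝓝[≠] a, zetaAdditionDefect L b (z + l) = zetaAdditionDefect L b z := by
  obtain ⟨c, hc⟩ := exists_weierstrassZeta_add L hl
  have htrans : Tendsto (· + b) (𝓝[≠] a) (𝓝[≠] (a + b)) :=
    ((hasDerivAt_id a).add_const b).tendsto_nhdsNE one_ne_zero
  filter_upwards [eventually_notMem_lattice L a, htrans.eventually (eventually_notMem_lattice L _)]
    with z hz hzb
  have hP := L.weierstrassP_add_coe z ⟨l, hl⟩
  have hPb := L.weierstrassP_add_coe (z + b) ⟨l, hl⟩
  simp only [zetaAdditionDefect, add_right_comm z l b, hc z hz, hc _ hzb, hP, hPb]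
  ring

lemma tendsto_zetaAdditionDefect_zero {b : ℂ} (hb : b ∉ L.lattice) :
    Tendsto (zetaAdditionDefect L b) (𝓝[≠] 0) (𝓝 0) := by
  -- `u` is the regular part at the origin of the function squared in the defect
  set u : ℂ → ℂ := fun z ↦
    weierstrassZetaRegular L z + L.weierstrassZeta b - L.weierstrassZeta (z + b) with hu
  have hu₀ : u 0 = 0 := by simp [hu, weierstrassZetaRegular_zero]
  have hu' : HasDerivAt u (L.weierstrassP b) 0 := by
    have hζ := (hasDerivAt_weierstrassZeta L (z := 0 + b) (by simpa using hb)).comp_add_const 0 b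
    refine (((hasDerivAt_weierstrassZetaRegular L (z := 0) (by simp)).add_const _).sub
      hζ).congr_deriv ?_
    simp
  have hslope : Tendsto (fun z ↦ u z / z) (𝓝[≠] 0) (𝓝 (L.weierstrassP b)) := by
    refine hu'.tendsto_slope.congr fun z ↦ ?_
    simp [slope_def_field, hu₀]
  have hP : Tendsto (fun z ↦ L.weierstrassP (z + b)) (𝓝[≠] 0) (𝓝 (L.weierstrassP b)) := by
    have hcont : ContinuousAt (fun z ↦ L.weierstrassP (z + b)) 0 :=
      (L.analyticOnNhd_weierstrassP b hb).continuousAt.comp_of_eq (by fun_prop) (zero_add b)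
    simpa using hcont.tendsto.mono_left nhdsWithin_le_nhds
  have hPE : Tendsto (L.weierstrassPExcept 0) (𝓝[≠] 0) (𝓝 0) := by
    have h₀ : L.weierstrassPExcept 0 0 = 0 := by simp [PeriodPair.weierstrassPExcept]
    simpa only [h₀] using
      (L.analyticAt_weierstrassPExcept 0).continuousAt.tendsto.mono_left nhdsWithin_le_nhds
  have hlim := (((hslope.const_mul 2).add ((hu'.continuousAt.tendsto.mono_left
    nhdsWithin_le_nhds).pow 2)).sub (hPE.add_const (L.weierstrassP b))).sub hP
  rw [hu₀] at hlim
  refine (hlim.congr' ?_).trans_eq (by ring_nf)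
  filter_upwards [self_mem_nhdsWithin] with z (hz : z ≠ 0)
  have hPz : L.weierstrassP z = 1 / z ^ 2 + L.weierstrassPExcept 0 z := by
    simpa [add_comm] using (L.weierstrassPExcept_add 0 z).symm
  simp only [zetaAdditionDefect, hu, weierstrassZeta_eq L z, hPz]
  field

lemma meromorphicOrderAt_zetaAdditionDefect_nonneg {b : ℂ} (hb : b ∉ L.lattice) (a : ℂ) :
    0 ≤ meromorphicOrderAt (zetaAdditionDefect L b) a := by
  have hlattice {l : ℂ} (hl : l ∈ L.lattice) :
      0 ≤ meromorphicOrderAt (zetaAdditionDefect L b) l := by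
    rw [← zero_add l, ← meromorphicOrderAt_fun_comp_add_const_eq_meromorphicOrderAt,
      meromorphicOrderAt_congr (zetaAdditionDefect_add_eventually L hl b 0),
      ← tendsto_nhds_iff_meromorphicOrderAt_nonneg (meromorphic_zetaAdditionDefect L b 0)]
    exact ⟨0, tendsto_zetaAdditionDefect_zero L hb⟩
  by_cases ha : a ∈ L.lattice
  · exact hlattice ha
  by_cases hab : a + b ∈ L.lattice
  · have hsymm : zetaAdditionDefect L b ∘ (fun z ↦ -b - z) = zetaAdditionDefect L b :=
      funext (zetaAdditionDefect_neg_sub L b)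
    rw [← hsymm, meromorphicOrderAt_comp_of_deriv_ne_zero (by fun_prop) (by simp)]
    exact hlattice (by simpa [neg_add', sub_eq_add_neg, add_comm] using neg_mem hab)
  · exact (analyticAt_zetaAdditionDefect L ha hab).meromorphicOrderAt_nonneg

lemma weierstrassZeta_addition {a b : ℂ} (ha : a ∉ L.lattice) (hb : b ∉ L.lattice)
    (hab : a + b ∉ L.lattice) :
    (L.weierstrassZeta a + L.weierstrassZeta b - L.weierstrassZeta (a + b)) ^ 2
      = L.weierstrassP a + L.weierstrassP b + L.weierstrassP (a + b) := by
  obtain ⟨c, hc⟩ := exists_eventuallyEq_const_of_periodic L (meromorphic_zetaAdditionDefect L b)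
    (meromorphicOrderAt_zetaAdditionDefect_nonneg L hb)
    (fun l hl a ↦ zetaAdditionDefect_add_eventually L hl b a)
  have hc₀ : c = 0 := tendsto_nhds_unique
    (tendsto_const_nhds.congr' (hc 0).symm) (tendsto_zetaAdditionDefect_zero L hb)
  have h := ((ContinuousAt.eventuallyEq_nhds_iff_eventuallyEq_nhdsNE
    (analyticAt_zetaAdditionDefect L ha hab).continuousAt continuousAt_const).1 (hc a)).eq_of_nhds
  exact sub_eq_zero.1 (h.trans hc₀)

end AdditionTheorem

section PeriodicZeta

variable (L : PeriodPair)

/-- The Weierstrass zeta function made periodic in the direction `ω₁` by a linear term. -/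
def periodicZeta (z : ℂ) : ℂ := L.weierstrassZeta z - 2 * L.etaOne / L.ω₁ * z

lemma periodicZeta_neg (z : ℂ) : periodicZeta L (-z) = -periodicZeta L z := by
  simp only [periodicZeta, weierstrassZeta_neg]
  ring

lemma hasDerivAt_periodicZeta {z : ℂ} (hz : z ∉ L.lattice) :
    HasDerivAt (periodicZeta L) (-(L.weierstrassP z + 2 * L.etaOne / L.ω₁)) z :=
  ((hasDerivAt_weierstrassZeta L hz).sub ((hasDerivAt_id z).const_mul _)).congr_deriv (by ring)

lemma analyticAt_periodicZeta {z : ℂ} (hz : z ∉ L.lattice) : AnalyticAt ℂ (periodicZeta L) z :=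
  (analyticAt_weierstrassZeta L hz).sub (analyticAt_const.mul analyticAt_id)

lemma periodPair_ω₁_ne_zero : L.ω₁ ≠ 0 := by
  simpa using L.indep.ne_zero 0

lemma periodicZeta_add_ω₁ {z : ℂ} (hz : z ∉ L.lattice) :
    periodicZeta L (z + L.ω₁) = periodicZeta L z := by
  have hω := periodPair_ω₁_ne_zero L
  rw [periodicZeta, periodicZeta, weierstrassZeta_add_ω₁ L hz]
  field

lemma exists_periodicZeta_add_ω₂ :
    ∃ c : ℂ, ∀ z ∉ L.lattice, periodicZeta L (z + L.ω₂) = periodicZeta L z + c := by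
  obtain ⟨c, hc⟩ := exists_weierstrassZeta_add L L.ω₂_mem_lattice
  refine ⟨c - 2 * L.etaOne / L.ω₁ * L.ω₂, fun z hz ↦ ?_⟩
  rw [periodicZeta, periodicZeta, hc z hz]
  ring

lemma meromorphic_periodicZeta : Meromorphic (periodicZeta L) := fun z ↦
  (meromorphic_weierstrassZeta L z).fun_sub
    (AnalyticAt.meromorphicAt (analyticAt_const.mul analyticAt_id))

lemma meromorphicOrderAt_periodicZeta {l : ℂ} (hl : l ∈ L.lattice) :
    meromorphicOrderAt (periodicZeta L) l = -1 := by
  have hlinear : AnalyticAt ℂ (fun z ↦ -(2 * L.etaOne / L.ω₁ * z)) l := by fun_prop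
  have h : periodicZeta L = L.weierstrassZeta + fun z ↦ -(2 * L.etaOne / L.ω₁ * z) :=
    funext fun z ↦ sub_eq_add_neg _ _
  rw [h, meromorphicOrderAt_add_eq_left_of_lt hlinear.meromorphicAt,
    meromorphicOrderAt_weierstrassZeta L hl]
  rw [meromorphicOrderAt_weierstrassZeta L hl]
  exact lt_of_lt_of_le (by decide) hlinear.meromorphicOrderAt_nonneg

lemma periodicZeta_addition {a b : ℂ} (ha : a ∉ L.lattice) (hb : b ∉ L.lattice)
    (hab : a + b ∉ L.lattice) :
    (periodicZeta L a + periodicZeta L b - periodicZeta L (a + b)) ^ 2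
      = L.weierstrassP a + L.weierstrassP b + L.weierstrassP (a + b) := by
  rw [← weierstrassZeta_addition L ha hb hab]
  simp only [periodicZeta]
  ring

end PeriodicZeta

section ThetaUniqueness

/-- The `n`-th Fourier coefficient on the real line of a function of period `1`. -/
def unitFourierCoeff (g : ℂ → ℂ) (n : ℤ) : ℂ :=
  ∫ x in (0 : ℝ)..1, g x * exp (-(2 * Real.pi * I * n * x))

lemma eq_zero_of_unitFourierCoeff_eq_zero {g : ℂ → ℂ} (hg : Differentiable ℂ g)
    (hper : ∀ z, g (z + 1) = g z) (h0 : ∀ n, unitFourierCoeff g n = 0) : g = 0 := by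
  have hp : Function.Periodic (fun x : ℝ ↦ g x) 1 := fun x ↦ by simpa using hper x
  have hc : Continuous fun x : ℝ ↦ g x := hg.continuous.comp continuous_ofReal
  let G : C(AddCircle (1 : ℝ), ℂ) := ⟨hp.lift, continuous_coinduced_dom.mpr hc⟩
  have hG (x : ℝ) : G x = g x := hp.lift_coe x
  have hcoeff : fourierCoeff G = 0 := by
    ext n
    have hint : ∫ x in (0 : ℝ)..1, fourier (-n) (x : AddCircle (1 : ℝ)) • G x
        = unitFourierCoeff g n :=
      intervalIntegral.integral_congr fun x _ ↦ by
        simp only [hG, fourier_coe_apply, smul_eq_mul, ofReal_one, div_one, Int.cast_neg]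
        rw [mul_comm]
        ring_nf
    rw [fourierCoeff_eq_intervalIntegral _ _ 0, zero_add, hint, h0, smul_zero, Pi.zero_apply]
  have hreal (x : ℝ) : g x = 0 := by
    have h := has_pointwise_sum_fourier_series_of_summable (f := G)
      (by rw [hcoeff]; exact summable_zero) x
    rw [hcoeff, hG] at h
    simpa using h.unique (by simp)
  have htendsto : Tendsto (fun x : ℝ ↦ (x : ℂ)) (𝓝[≠] 0) (𝓝[≠] 0) := by
    exact ofRealCLM.hasDerivAt.tendsto_nhdsNE (x := (0 : ℝ)) (by simp)
  exact AnalyticOnNhd.eq_of_frequently_eq (fun z _ ↦ hg.analyticAt z)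
    (fun z _ ↦ analyticAt_const) (htendsto.frequently (.of_forall hreal))

lemma integral_ofReal_add_of_periodic {F : ℂ → ℂ} (hF : Differentiable ℂ F)
    (hper : ∀ z, F (z + 1) = F z) (w : ℂ) :
    ∫ x in (0 : ℝ)..1, F (x + w) = ∫ x in (0 : ℝ)..1, F x := by
  have hrect := integral_boundary_rect_eq_zero_of_differentiableOn F w.re
    (1 + w.re + w.im * I) hF.differentiableOn
  have hsides (y : ℝ) : F (1 + w.re + y * I) = F (w.re + y * I) := by
    rw [add_assoc, add_comm, hper]
  have hperiodic : Function.Periodic (fun x : ℝ ↦ F x) 1 := fun x ↦ by simpa using hper x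
  have htop : ∫ x in w.re..1 + w.re, F (x + w.im * I) = ∫ x in w.re..1 + w.re, F x := by
    simp [hsides] at hrect
    linear_combination -hrect
  calc
    ∫ x in (0 : ℝ)..1, F (x + w) = ∫ x in (0 : ℝ)..1, F ((x + w.re : ℝ) + w.im * I) := by
      simp only [ofReal_add, add_assoc, re_add_im]
    _ = ∫ x in w.re..1 + w.re, F (x + w.im * I) := by
      rw [intervalIntegral.integral_comp_add_right (fun x : ℝ ↦ F (x + w.im * I)), zero_add]
    _ = ∫ x in (0 : ℝ)..1, F x := by
      rw [htop, add_comm, hperiodic.intervalIntegral_add_eq w.re 0, zero_add]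

lemma unitFourierCoeff_eq_exp_mul_of_quasiPeriodic {τ : ℂ} {g : ℂ → ℂ}
    (hg : Differentiable ℂ g) (h1 : ∀ z, g (z + 1) = g z)
    (hτ : ∀ z, g (z + τ) = exp (-Real.pi * I * (τ + 2 * z)) * g z) (n : ℤ) :
    unitFourierCoeff g n = exp (-Real.pi * I * (2 * n + 1) * τ) * unitFourierCoeff g (n + 1) := by
  have hshift := integral_ofReal_add_of_periodic
    (F := fun z ↦ g z * exp (-(2 * Real.pi * I * n * z))) (by fun_prop) (fun z ↦ by
      rw [h1, show -(2 * Real.pi * I * n * (z + 1))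
        = -(2 * Real.pi * I * n * z) - n * (2 * Real.pi * I) by ring, exp_sub,
        exp_int_mul_two_pi_mul_I, div_one]) τ
  rw [unitFourierCoeff, unitFourierCoeff, ← hshift, ← intervalIntegral.integral_const_mul]
  refine intervalIntegral.integral_congr fun x _ ↦ ?_
  have hexp : exp (-Real.pi * I * (τ + 2 * x)) * exp (-(2 * Real.pi * I * n * (x + τ)))
      = exp (-Real.pi * I * (2 * n + 1) * τ) * exp (-(2 * Real.pi * I * (n + 1 : ℤ) * x)) := by
    rw [← exp_add, ← exp_add]
    push_cast
    ring_nf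
  simp only [hτ]
  linear_combination g x * hexp

lemma eq_zero_of_quasiPeriodic {τ : ℂ} {g : ℂ → ℂ} (hg : Differentiable ℂ g)
    (h1 : ∀ z, g (z + 1) = g z)
    (hτ : ∀ z, g (z + τ) = exp (-Real.pi * I * (τ + 2 * z)) * g z)
    (h0 : ∫ x in (0 : ℝ)..1, g x = 0) : g = 0 := by
  have hrec := unitFourierCoeff_eq_exp_mul_of_quasiPeriodic hg h1 hτ
  refine eq_zero_of_unitFourierCoeff_eq_zero hg h1 fun n ↦ ?_
  induction n using Int.induction_on with
  | zero => simpa [unitFourierCoeff] using h0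
  | succ n ih => exact (mul_eq_zero.1 ((hrec n).symm.trans ih)).resolve_left (exp_ne_zero _)
  | pred n ih => rw [hrec, sub_add_cancel, ih, mul_zero]

lemma integral_jacobiTheta₂ {τ : ℂ} (hτ : 0 < τ.im) :
    ∫ x in (0 : ℝ)..1, jacobiTheta₂ x τ = 1 := by
  have hterm (n : ℤ) : ∫ x in (0 : ℝ)..1, jacobiTheta₂_term n x τ = if n = 0 then 1 else 0 := by
    split_ifs with hn
    · simp [hn, jacobiTheta₂_term]
    · have hfreq : 2 * Real.pi * I * n ≠ 0 := mul_ne_zero two_pi_I_ne_zero (mod_cast hn)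
      simp only [jacobiTheta₂_term, exp_add, intervalIntegral.integral_mul_const,
        integral_exp_mul_complex hfreq]
      rw [ofReal_one, mul_one, ofReal_zero, mul_zero, exp_zero, mul_comm _ (n : ℂ),
        exp_int_mul_two_pi_mul_I, sub_self, zero_div, zero_mul]
  let term (n : ℤ) : C(ℝ, ℂ) := ⟨fun x ↦ jacobiTheta₂_term n x τ, by
    unfold jacobiTheta₂_term
    fun_prop⟩
  have hsummable : Summable fun n ↦
      ‖(term n).restrict (⟨Set.uIcc 0 1, isCompact_uIcc⟩ : TopologicalSpace.Compacts ℝ)‖ := by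
    refine .of_nonneg_of_le (fun _ ↦ norm_nonneg _) (fun n ↦ ?_)
      (summable_pow_mul_jacobiTheta₂_term_bound 0 hτ 0)
    rw [pow_zero, one_mul]
    exact (ContinuousMap.norm_le _ (Real.exp_pos _).le).2 fun x ↦
      norm_jacobiTheta₂_term_le hτ (by simp) le_rfl n
  have hsum := intervalIntegral.hasSum_intervalIntegral_of_summable_norm hsummable
  exact hsum.unique (by simpa [term, hterm] using hasSum_ite_eq (0 : ℤ) (1 : ℂ))

lemma eq_integral_mul_jacobiTheta₂ {τ : ℂ} (hτ : 0 < τ.im) {g : ℂ → ℂ} (hg : Differentiable ℂ g)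
    (h1 : ∀ z, g (z + 1) = g z)
    (h2 : ∀ z, g (z + τ) = exp (-Real.pi * I * (τ + 2 * z)) * g z) (z : ℂ) :
    g z = (∫ x in (0 : ℝ)..1, g x) * jacobiTheta₂ z τ := by
  have hθ : Differentiable ℂ fun z ↦ jacobiTheta₂ z τ := fun z ↦
    differentiableAt_jacobiTheta₂_fst z hτ
  set c : ℂ := ∫ x in (0 : ℝ)..1, g x
  refine sub_eq_zero.1 (congrFun (eq_zero_of_quasiPeriodic (τ := τ)
    (g := fun z ↦ g z - c * jacobiTheta₂ z τ) (hg.sub (hθ.const_mul c))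
    (fun z ↦ ?_) (fun z ↦ ?_) ?_) z)
  · rw [h1, jacobiTheta₂_add_left]
  · rw [h2, jacobiTheta₂_add_left']
    ring
  · have hgi : IntervalIntegrable (fun x : ℝ ↦ g x) MeasureTheory.volume 0 1 :=
      (hg.continuous.comp continuous_ofReal).intervalIntegrable _ _
    have hθi : IntervalIntegrable (fun x : ℝ ↦ c * jacobiTheta₂ x τ) MeasureTheory.volume 0 1 :=
      (continuous_const.mul (hθ.continuous.comp continuous_ofReal)).intervalIntegrable _ _
    rw [intervalIntegral.integral_sub hgi hθi, intervalIntegral.integral_const_mul,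
      integral_jacobiTheta₂ hτ, mul_one, sub_self]

end ThetaUniqueness

section JacobiThetaOne

lemma jacobiThetaOne_eq (v τ : ℂ) :
    jacobiThetaOne v τ = I * exp (Real.pi * I * (τ / 4 - v))
      * jacobiTheta₂ (v + 1 / 2 - τ / 2) τ := by
  rw [jacobiThetaOne, jacobiTheta₂, mul_assoc I,
    ← tsum_mul_left (f := fun n ↦ jacobiTheta₂_term n _ τ)]
  congr 2
  funext n
  have hsign : ((-1 : ℂ)) ^ n = exp (Real.pi * I * n) := by
    rw [mul_comm, exp_int_mul, exp_pi_mul_I]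
  rw [hsign, jacobiTheta₂_term, ← exp_add, ← exp_add, ← exp_add]
  congr 1
  ring

lemma differentiable_jacobiThetaOne {τ : ℂ} (hτ : 0 < τ.im) :
    Differentiable ℂ fun v ↦ jacobiThetaOne v τ := by
  have hθ : Differentiable ℂ fun z ↦ jacobiTheta₂ z τ := fun z ↦
    differentiableAt_jacobiTheta₂_fst z hτ
  have hθ' : Differentiable ℂ fun v ↦ jacobiTheta₂ (v + 1 / 2 - τ / 2) τ :=
    hθ.comp (f := fun v ↦ v + 1 / 2 - τ / 2) (by fun_prop)
  simp only [jacobiThetaOne_eq]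
  fun_prop

lemma jacobiThetaOne_neg (v τ : ℂ) : jacobiThetaOne (-v) τ = -jacobiThetaOne v τ := by
  rw [jacobiThetaOne, jacobiThetaOne, ← (Equiv.subLeft (1 : ℤ)).tsum_eq, ← mul_neg, ← tsum_neg]
  congr 2
  funext n
  have hsign : (-1 : ℂ) ^ (1 - n) = -(-1) ^ n := by
    rw [zpow_sub₀ (by norm_num), zpow_one, div_eq_mul_inv, ← inv_zpow, inv_neg_one, neg_one_mul]
  rw [Equiv.subLeft_apply, hsign, neg_mul, neg_mul]
  push_cast
  ring_nf

lemma jacobiThetaOne_add_one (v τ : ℂ) : jacobiThetaOne (v + 1) τ = -jacobiThetaOne v τ := by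
  rw [jacobiThetaOne_eq, jacobiThetaOne_eq,
    show v + 1 + 1 / 2 - τ / 2 = v + 1 / 2 - τ / 2 + 1 by ring, jacobiTheta₂_add_left,
    show Real.pi * I * (τ / 4 - (v + 1)) = Real.pi * I * (τ / 4 - v) - Real.pi * I by ring,
    exp_sub, exp_pi_mul_I]
  ring

lemma jacobiThetaOne_add_tau (v τ : ℂ) :
    jacobiThetaOne (v + τ) τ = -exp (-Real.pi * I * (τ + 2 * v)) * jacobiThetaOne v τ := by
  have hexp : exp (Real.pi * I * (τ / 4 - (v + τ)))
        * exp (-Real.pi * I * (τ + 2 * (v + 1 / 2 - τ / 2)))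
      = -exp (-Real.pi * I * (τ + 2 * v)) * exp (Real.pi * I * (τ / 4 - v)) := by
    rw [← exp_add, neg_mul (exp _), ← exp_add, ← exp_sub_pi_mul_I]
    ring_nf
  rw [jacobiThetaOne_eq, jacobiThetaOne_eq,
    show v + τ + 1 / 2 - τ / 2 = v + 1 / 2 - τ / 2 + τ by ring, jacobiTheta₂_add_left']
  linear_combination I * jacobiTheta₂ (v + 1 / 2 - τ / 2) τ * hexp

lemma exists_jacobiThetaOne_ne_zero {τ : ℂ} (hτ : 0 < τ.im) : ∃ v, jacobiThetaOne v τ ≠ 0 := by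
  by_contra! h
  have hzero (z : ℂ) : jacobiTheta₂ z τ = 0 := by
    have h' := h (z - 1 / 2 + τ / 2)
    rw [jacobiThetaOne_eq, show z - 1 / 2 + τ / 2 + 1 / 2 - τ / 2 = z by ring] at h'
    exact (mul_eq_zero.1 h').resolve_left (mul_ne_zero I_ne_zero (exp_ne_zero _))
  simpa [hzero] using integral_jacobiTheta₂ hτ

lemma exists_eq_const_mul_jacobiThetaOne {τ : ℂ} (hτ : 0 < τ.im) {f : ℂ → ℂ}
    (hf : Differentiable ℂ f) (h1 : ∀ v, f (v + 1) = -f v)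
    (h2 : ∀ v, f (v + τ) = -exp (-Real.pi * I * (τ + 2 * v)) * f v) :
    ∃ c, ∀ v, f v = c * jacobiThetaOne v τ := by
  have hperiod (z : ℂ) : f (z + 1 - 1 / 2 + τ / 2) * exp (Real.pi * I * (z + 1))
      = f (z - 1 / 2 + τ / 2) * exp (Real.pi * I * z) := by
    rw [show z + 1 - 1 / 2 + τ / 2 = z - 1 / 2 + τ / 2 + 1 by ring, h1, mul_add, exp_add, mul_one,
      exp_pi_mul_I]
    ring
  have hquasi (z : ℂ) : f (z + τ - 1 / 2 + τ / 2) * exp (Real.pi * I * (z + τ))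
      = exp (-Real.pi * I * (τ + 2 * z))
        * (f (z - 1 / 2 + τ / 2) * exp (Real.pi * I * z)) := by
    have hexp : exp (-Real.pi * I * (τ + 2 * (z - 1 / 2 + τ / 2))) * exp (Real.pi * I * (z + τ))
        = -(exp (-Real.pi * I * (τ + 2 * z)) * exp (Real.pi * I * z)) := by
      rw [← exp_add, ← exp_add, ← exp_add_pi_mul_I]
      ring_nf
    rw [show z + τ - 1 / 2 + τ / 2 = z - 1 / 2 + τ / 2 + τ by ring, h2]
    linear_combination -f (z - 1 / 2 + τ / 2) * hexp
  have hg : Differentiable ℂ fun z ↦ f (z - 1 / 2 + τ / 2) * exp (Real.pi * I * z) :=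
    (hf.comp (f := fun z : ℂ ↦ z - 1 / 2 + τ / 2) (by fun_prop)).mul (by fun_prop)
  have hmultiple := eq_integral_mul_jacobiTheta₂ hτ hg hperiod hquasi
  generalize (∫ x in (0 : ℝ)..1, f (x - 1 / 2 + τ / 2) * exp (Real.pi * I * x)) = c at hmultiple
  refine ⟨c * (I * exp (Real.pi * I * (1 / 2 - τ / 4)))⁻¹, fun v ↦ ?_⟩
  have hv := hmultiple (v + 1 / 2 - τ / 2)
  have hexp : exp (Real.pi * I * (1 / 2 - τ / 4))
      = exp (Real.pi * I * (τ / 4 - v)) * exp (Real.pi * I * (v + 1 / 2 - τ / 2)) := by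
    rw [← exp_add]
    ring_nf
  rw [show v + 1 / 2 - τ / 2 - 1 / 2 + τ / 2 = v by ring, ← eq_div_iff (exp_ne_zero _)] at hv
  rw [jacobiThetaOne_eq, hexp, hv]
  field_simp [exp_ne_zero]

end JacobiThetaOne

section LatticeTheta

variable (L : PeriodPair)

/-- The theta function `ϑ₁` rescaled so that its zeros are the points of the lattice `L`, provided
that the periods are ordered such that `ω₂ / ω₁` lies in the upper half plane. -/
def latticeTheta (z : ℂ) : ℂ :=
  jacobiThetaOne (z / L.ω₁) (L.ω₂ / L.ω₁)

/-- The factor by which `latticeTheta` is multiplied under translation by the second period. -/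
def thetaMultiplier (z : ℂ) : ℂ :=
  -exp (-Real.pi * I * (L.ω₂ / L.ω₁ + 2 * (z / L.ω₁)))

lemma latticeTheta_neg (z : ℂ) : latticeTheta L (-z) = -latticeTheta L z := by
  rw [latticeTheta, neg_div, jacobiThetaOne_neg, latticeTheta]

lemma latticeTheta_zero : latticeTheta L 0 = 0 := by
  simpa [CharZero.eq_neg_self_iff] using latticeTheta_neg L 0

lemma latticeTheta_add_ω₁ (z : ℂ) : latticeTheta L (z + L.ω₁) = -latticeTheta L z := by
  rw [latticeTheta, add_div, div_self (periodPair_ω₁_ne_zero L), jacobiThetaOne_add_one,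
    latticeTheta]

lemma latticeTheta_add_ω₂ (z : ℂ) :
    latticeTheta L (z + L.ω₂) = thetaMultiplier L z * latticeTheta L z := by
  rw [latticeTheta, add_div, jacobiThetaOne_add_tau, latticeTheta, thetaMultiplier]

lemma hasDerivAt_thetaMultiplier (z : ℂ) :
    HasDerivAt (thetaMultiplier L) (-(2 * Real.pi * I / L.ω₁) * thetaMultiplier L z) z := by
  refine ((((((hasDerivAt_id z).div_const L.ω₁).const_mul 2).const_add
    (L.ω₂ / L.ω₁)).const_mul (-Real.pi * I)).cexp.fun_neg).congr_deriv ?_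
  simp only [thetaMultiplier, id_eq]
  ring

lemma continuous_thetaMultiplier : Continuous (thetaMultiplier L) :=
  continuous_iff_continuousAt.2 fun z ↦ (hasDerivAt_thetaMultiplier L z).continuousAt

variable {L}

lemma differentiable_latticeTheta (hL : 0 < (L.ω₂ / L.ω₁).im) :
    Differentiable ℂ (latticeTheta L) :=
  (differentiable_jacobiThetaOne hL).comp (f := fun z : ℂ ↦ z / L.ω₁) (by fun_prop)

lemma exists_eq_const_mul_latticeTheta (hL : 0 < (L.ω₂ / L.ω₁).im) {f : ℂ → ℂ}
    (hf : Meromorphic f) (hord : ∀ a, 0 ≤ meromorphicOrderAt f a)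
    (h₁ : ∀ z ∉ L.lattice, f (z + L.ω₁) = -f z)
    (h₂ : ∀ z ∉ L.lattice, f (z + L.ω₂) = thetaMultiplier L z * f z) :
    ∃ c, ∀ a, f =ᶠ[𝓝[≠] a] fun z ↦ c * latticeTheta L z := by
  obtain ⟨F, hF, hfF⟩ := exists_differentiable_eventuallyEq_nhdsNE hf hord
  have hω := periodPair_ω₁_ne_zero L
  have hF₁ (z : ℂ) : F (z + L.ω₁) = -1 * F z :=
    eq_mul_of_eventuallyEq_nhdsNE (m := fun _ ↦ -1) hF.continuous continuous_const hfF (fun a ↦ by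
      filter_upwards [eventually_notMem_lattice L a] with w hw
      rw [h₁ w hw, neg_one_mul]) z
  have hF₂ (z : ℂ) : F (z + L.ω₂) = thetaMultiplier L z * F z :=
    eq_mul_of_eventuallyEq_nhdsNE hF.continuous (continuous_thetaMultiplier L) hfF (fun a ↦ by
      filter_upwards [eventually_notMem_lattice L a] with w hw using h₂ w hw) z
  obtain ⟨c, hc⟩ := exists_eq_const_mul_jacobiThetaOne hL (f := fun v ↦ F (L.ω₁ * v))
    (hF.comp (f := fun v ↦ L.ω₁ * v) (by fun_prop))
    (fun v ↦ by rw [mul_add, mul_one, hF₁, neg_one_mul])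
    (fun v ↦ by
      rw [mul_add, mul_div_cancel₀ _ hω, hF₂, thetaMultiplier, mul_div_cancel_left₀ _ hω])
  refine ⟨c, fun a ↦ (hfF a).trans (.of_forall fun z ↦ ?_)⟩
  simp only [latticeTheta, ← hc, mul_div_cancel₀ _ hω]

lemma meromorphicOrderAt_latticeTheta_ne_top (hL : 0 < (L.ω₂ / L.ω₁).im) (a : ℂ) :
    meromorphicOrderAt (latticeTheta L) a ≠ ⊤ := by
  intro htop
  have hd := differentiable_latticeTheta hL
  have hzero : latticeTheta L = 0 := AnalyticOnNhd.eq_of_frequently_eq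
    (fun z _ ↦ hd.analyticAt z) (fun z _ ↦ analyticAt_const)
    (meromorphicOrderAt_eq_top_iff.1 htop).frequently
  obtain ⟨v, hv⟩ := exists_jacobiThetaOne_ne_zero hL
  refine hv ?_
  have hv' := congrFun hzero (L.ω₁ * v)
  rwa [latticeTheta, mul_div_cancel_left₀ _ (periodPair_ω₁_ne_zero L)] at hv'

lemma meromorphicOrderAt_add_of_quasiPeriodic {f m : ℂ → ℂ} {l a : ℂ} (hf : MeromorphicAt f a)
    (hm : AnalyticAt ℂ m a) (hm₀ : m a ≠ 0) (h : ∀ z, f (z + l) = m z * f z) :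
    meromorphicOrderAt f (a + l) = meromorphicOrderAt f a := by
  have hm_order : meromorphicOrderAt m a = 0 := by
    rw [hm.meromorphicOrderAt_eq, hm.analyticOrderAt_eq_zero.2 hm₀]
    rfl
  rw [← meromorphicOrderAt_fun_comp_add_const_eq_meromorphicOrderAt, funext h,
    fun_meromorphicOrderAt_mul hm.meromorphicAt hf, hm_order, zero_add]

lemma meromorphicOrderAt_latticeTheta_add (hL : 0 < (L.ω₂ / L.ω₁).im) {l : ℂ}
    (hl : l ∈ L.lattice) (a : ℂ) :
    meromorphicOrderAt (latticeTheta L) (a + l) = meromorphicOrderAt (latticeTheta L) a := by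
  have hmero (a : ℂ) : MeromorphicAt (latticeTheta L) a :=
    ((differentiable_latticeTheta hL).analyticAt a).meromorphicAt
  rw [PeriodPair.lattice, ← Submodule.mem_toAddSubgroup,
    Submodule.span_int_eq_addSubgroupClosure] at hl
  induction hl using AddSubgroup.closure_induction generalizing a with
  | mem l hl =>
    obtain rfl | rfl := hl
    · exact meromorphicOrderAt_add_of_quasiPeriodic (m := fun _ ↦ -1) (hmero a) analyticAt_const
        (by simp) fun z ↦ by rw [latticeTheta_add_ω₁, neg_one_mul]
    · have hm : Differentiable ℂ (thetaMultiplier L) := fun z ↦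
        (hasDerivAt_thetaMultiplier L z).differentiableAt
      exact meromorphicOrderAt_add_of_quasiPeriodic (hmero a) (hm.analyticAt a)
        (neg_ne_zero.2 (exp_ne_zero _)) (latticeTheta_add_ω₂ L)
  | zero => rw [add_zero]
  | add l l' _ _ hl hl' => rw [← add_assoc, hl', hl]
  | neg l _ hl => rw [← hl, neg_add_cancel_right]

lemma meromorphicOrderAt_latticeTheta_of_mem (hL : 0 < (L.ω₂ / L.ω₁).im) {l : ℂ}
    (hl : l ∈ L.lattice) :
    meromorphicOrderAt (latticeTheta L) l = meromorphicOrderAt (latticeTheta L) 0 := by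
  simpa only [zero_add] using meromorphicOrderAt_latticeTheta_add hL hl 0

lemma natCast_le_meromorphicOrderAt_iff {f : ℂ → ℂ} {a : ℂ} (hf : AnalyticAt ℂ f a) (n : ℕ) :
    (n : WithTop ℤ) ≤ meromorphicOrderAt f a ↔ ∀ i < n, iteratedDeriv i f a = 0 := by
  rw [← natCast_le_analyticOrderAt_iff_iteratedDeriv_eq_zero hf, hf.meromorphicOrderAt_eq]
  cases analyticOrderAt f a with
  | top => simp
  | coe k => exact (WithTop.coe_le_coe (α := ℤ)).trans Nat.cast_le |>.trans Nat.cast_le.symm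

-- If `ϑ` had a double zero at the origin, `ϑ ℘` would be a multiple of `ϑ` by uniqueness.
lemma deriv_latticeTheta_zero_ne_zero (hL : 0 < (L.ω₂ / L.ω₁).im) :
    deriv (latticeTheta L) 0 ≠ 0 := by
  intro hderiv
  have hd := differentiable_latticeTheta hL
  have hmero (a : ℂ) := (hd.analyticAt a).meromorphicAt
  have hdouble : (2 : ℕ) ≤ meromorphicOrderAt (latticeTheta L) 0 := by
    refine (natCast_le_meromorphicOrderAt_iff (hd.analyticAt 0) 2).2 fun i hi ↦ ?_
    interval_cases i
    · simpa using latticeTheta_zero L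
    · simpa using hderiv
  have horder {a : ℂ} (ha : a ∈ L.lattice) :
      meromorphicOrderAt (latticeTheta L * L.weierstrassP) a
        = meromorphicOrderAt (latticeTheta L) 0 + (-2 : ℤ) := by
    rw [meromorphicOrderAt_mul (hmero a) (L.meromorphic_weierstrassP a),
      L.order_weierstrassP a ha, meromorphicOrderAt_latticeTheta_of_mem hL ha]
    rfl
  have horder_nonneg (a : ℂ) : 0 ≤ meromorphicOrderAt (latticeTheta L * L.weierstrassP) a := by
    by_cases ha : a ∈ L.lattice
    · rw [horder ha]
      exact add_le_add_left hdouble (-2 : ℤ)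
    · exact ((hd.analyticAt a).mul (L.analyticOnNhd_weierstrassP a ha)).meromorphicOrderAt_nonneg
  obtain ⟨c, hc⟩ := exists_eq_const_mul_latticeTheta hL
    (fun a ↦ (hmero a).mul (L.meromorphic_weierstrassP a)) horder_nonneg
    (fun z _ ↦ by
      have hper := L.weierstrassP_add_coe z ⟨L.ω₁, L.ω₁_mem_lattice⟩
      simp only [Pi.mul_apply, hper, latticeTheta_add_ω₁, neg_mul])
    (fun z _ ↦ by
      have hper := L.weierstrassP_add_coe z ⟨L.ω₂, L.ω₂_mem_lattice⟩
      simp only [Pi.mul_apply, hper, latticeTheta_add_ω₂, mul_assoc])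
  have hc_order : 0 ≤ meromorphicOrderAt (fun _ : ℂ ↦ c) 0 :=
    analyticAt_const.meromorphicOrderAt_nonneg
  have hcontra := meromorphicOrderAt_congr (hc 0)
  rw [horder (zero_mem _), fun_meromorphicOrderAt_mul (.const c 0) (hmero 0)] at hcontra
  lift meromorphicOrderAt (latticeTheta L) 0 to ℤ using
    meromorphicOrderAt_latticeTheta_ne_top hL 0 with n
  cases hm : meromorphicOrderAt (fun _ : ℂ ↦ c) 0 with
  | top => simp [hm] at hcontra
  | coe m =>
    rw [hm] at hcontra hc_order
    norm_cast at hcontra hc_order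
    omega

variable (L) in
lemma deriv_latticeTheta_neg (z : ℂ) : deriv (latticeTheta L) (-z) = deriv (latticeTheta L) z := by
  have h := deriv_comp_neg (latticeTheta L) z
  simp only [latticeTheta_neg, deriv.fun_neg] at h
  exact (neg_injective h).symm

variable (L) in
lemma deriv_latticeTheta_add_ω₁ (z : ℂ) :
    deriv (latticeTheta L) (z + L.ω₁) = -deriv (latticeTheta L) z := by
  rw [← deriv_comp_add_const, funext (latticeTheta_add_ω₁ L), deriv.fun_neg]

lemma deriv_latticeTheta_add_ω₂ (hL : 0 < (L.ω₂ / L.ω₁).im) (z : ℂ) :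
    deriv (latticeTheta L) (z + L.ω₂) = thetaMultiplier L z *
      (deriv (latticeTheta L) z - 2 * Real.pi * I / L.ω₁ * latticeTheta L z) := by
  rw [← deriv_comp_add_const, funext (latticeTheta_add_ω₂ L),
    ((hasDerivAt_thetaMultiplier L z).fun_mul (differentiable_latticeTheta hL z).hasDerivAt).deriv]
  ring

lemma meromorphicOrderAt_latticeTheta_mul_periodicZeta_nonneg (hL : 0 < (L.ω₂ / L.ω₁).im)
    (a : ℂ) : 0 ≤ meromorphicOrderAt (latticeTheta L * periodicZeta L) a := by
  have hd := differentiable_latticeTheta hL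
  by_cases ha : a ∈ L.lattice
  · have hzero : (1 : ℕ) ≤ meromorphicOrderAt (latticeTheta L) 0 := by
      refine (natCast_le_meromorphicOrderAt_iff (hd.analyticAt 0) 1).2 fun i hi ↦ ?_
      simpa [Nat.lt_one_iff.1 hi] using latticeTheta_zero L
    rw [meromorphicOrderAt_mul (hd.analyticAt a).meromorphicAt (meromorphic_periodicZeta L a),
      meromorphicOrderAt_periodicZeta L ha, meromorphicOrderAt_latticeTheta_of_mem hL ha]
    exact add_le_add_left hzero (-1)
  · exact ((hd.analyticAt a).mul (analyticAt_periodicZeta L ha)).meromorphicOrderAt_nonneg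

-- `k` is chosen such that `ϑ ζ̂ - k ϑ'`, with `ζ̂` the periodic zeta function, has the multipliers
-- of `ϑ`. It is then a multiple of `ϑ`, and vanishes because it is even while `ϑ` is odd.
lemma exists_latticeTheta_mul_periodicZeta_eq (hL : 0 < (L.ω₂ / L.ω₁).im) :
    ∃ k, ∀ z ∉ L.lattice,
      latticeTheta L z * periodicZeta L z = k * deriv (latticeTheta L) z := by
  obtain ⟨c, hc⟩ := exists_periodicZeta_add_ω₂ L
  have hd := differentiable_latticeTheta hL
  set k : ℂ := -c * L.ω₁ / (2 * Real.pi * I) with hk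
  have hkc : k * (2 * Real.pi * I / L.ω₁) = -c := by
    have := periodPair_ω₁_ne_zero L
    have := two_pi_I_ne_zero
    rw [hk]
    field_simp
  have hmero (a : ℂ) : MeromorphicAt (latticeTheta L * periodicZeta L) a :=
    (hd.analyticAt a).meromorphicAt.mul (meromorphic_periodicZeta L a)
  set f : ℂ → ℂ := latticeTheta L * periodicZeta L - fun z ↦ k * deriv (latticeTheta L) z with hf
  have hderiv (a : ℂ) : AnalyticAt ℂ (fun z ↦ k * deriv (latticeTheta L) z) a :=
    analyticAt_const.mul (hd.analyticAt a).deriv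
  have hanalytic {z : ℂ} (hz : z ∉ L.lattice) : AnalyticAt ℂ f z :=
    ((hd.analyticAt z).mul (analyticAt_periodicZeta L hz)).sub (hderiv z)
  obtain ⟨b, hb⟩ := exists_eq_const_mul_latticeTheta hL (f := f)
    (fun a ↦ (hmero a).sub (hderiv a).meromorphicAt)
    (fun a ↦ (le_min (meromorphicOrderAt_latticeTheta_mul_periodicZeta_nonneg hL a)
      (hderiv a).neg.meromorphicOrderAt_nonneg).trans
        (by simpa only [hf, sub_eq_add_neg] using
          meromorphicOrderAt_add (hmero a) (hderiv a).neg.meromorphicAt))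
    (fun z hz ↦ by
      simp only [hf, Pi.sub_apply, Pi.mul_apply, deriv_latticeTheta_add_ω₁, latticeTheta_add_ω₁,
        periodicZeta_add_ω₁ L hz]
      ring)
    (fun z hz ↦ by
      simp only [hf, Pi.sub_apply, Pi.mul_apply, deriv_latticeTheta_add_ω₂ hL,
        latticeTheta_add_ω₂, hc z hz]
      linear_combination thetaMultiplier L z * latticeTheta L z * hkc)
  have hfb {z : ℂ} (hz : z ∉ L.lattice) : f z = b * latticeTheta L z :=
    (((hanalytic hz).continuousAt.eventuallyEq_nhds_iff_eventuallyEq_nhdsNE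
      (continuousAt_const.mul (hd z).continuousAt)).1 (hb z)).self_of_nhds
  refine ⟨k, fun z hz ↦ sub_eq_zero.1 (?_ : f z = 0)⟩
  have hfz := hfb hz
  have hfz_neg := hfb (z := -z) fun h ↦ hz (by simpa using neg_mem h)
  have heven : f (-z) = f z := by
    simp only [hf, Pi.sub_apply, Pi.mul_apply, latticeTheta_neg, deriv_latticeTheta_neg,
      periodicZeta_neg, neg_mul_neg]
  rw [heven, latticeTheta_neg] at hfz_neg
  linear_combination (hfz + hfz_neg) / 2

lemma hasDerivAt_latticeTheta (hL : 0 < (L.ω₂ / L.ω₁).im) {z : ℂ} (hz : z ∉ L.lattice) :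
    HasDerivAt (latticeTheta L) (latticeTheta L z * periodicZeta L z) z := by
  have hd := differentiable_latticeTheta hL
  obtain ⟨k, hk⟩ := exists_latticeTheta_mul_periodicZeta_eq hL
  have hlim : Tendsto (fun z ↦ latticeTheta L z * periodicZeta L z) (𝓝[≠] 0)
      (𝓝 (deriv (latticeTheta L) 0)) := by
    have hreg : ContinuousAt (fun w ↦ latticeTheta L w * (weierstrassZetaRegular L w
        - 2 * L.etaOne / L.ω₁ * w)) 0 := by
      have := (hasDerivAt_weierstrassZetaRegular L (z := 0) (by simp)).continuousAt
      have := (hd 0).continuousAt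
      fun_prop
    have hsum := (hd 0).hasDerivAt.tendsto_slope.add (hreg.tendsto.mono_left nhdsWithin_le_nhds)
    rw [latticeTheta_zero, zero_mul, add_zero] at hsum
    refine hsum.congr fun w ↦ ?_
    rw [slope_def_field, latticeTheta_zero, periodicZeta, weierstrassZeta_eq]
    ring
  have hlim_k : Tendsto (fun z ↦ k * deriv (latticeTheta L) z) (𝓝[≠] 0)
      (𝓝 (k * deriv (latticeTheta L) 0)) :=
    (continuousAt_const.mul (hd.analyticAt 0).deriv.continuousAt).tendsto.mono_left
      nhdsWithin_le_nhds
  have hlim_eq := tendsto_nhds_unique hlim (hlim_k.congr' (by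
    filter_upwards [eventually_notMem_lattice L 0] with w hw using (hk w hw).symm))
  have hk_one : k = 1 :=
    mul_right_cancel₀ (deriv_latticeTheta_zero_ne_zero hL) (by linear_combination -hlim_eq)
  rw [hk z hz, hk_one, one_mul]
  exact (hd z).hasDerivAt

lemma latticeTheta_ne_zero (hL : 0 < (L.ω₂ / L.ω₁).im) {z : ℂ} (hz : z ∉ L.lattice) :
    latticeTheta L z ≠ 0 := by
  intro hzero
  have hθ := (differentiable_latticeTheta hL).analyticAt z
  have hlogDeriv : logDeriv (latticeTheta L) =ᶠ[𝓝[≠] z] periodicZeta L := by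
    have hne : ∀ᶠ w in 𝓝[≠] z, latticeTheta L w ≠ 0 :=
      hθ.eventually_eq_zero_or_eventually_ne_zero.resolve_left fun h ↦
        meromorphicOrderAt_latticeTheta_ne_top hL z
          (meromorphicOrderAt_eq_top_iff.2 (h.filter_mono nhdsWithin_le_nhds))
    filter_upwards [hne, eventually_notMem_lattice L z] with w hw hwL
    rw [logDeriv_apply, (hasDerivAt_latticeTheta hL hwL).deriv, mul_div_cancel_left₀ _ hw]
  have horder : meromorphicOrderAt (latticeTheta L) z ≠ 0 := by
    intro h
    have hlim := hθ.continuousAt.tendsto.mono_left (nhdsWithin_le_nhds (s := {z}ᶜ))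
    rw [hzero, tendsto_zero_iff_meromorphicOrderAt_pos hθ.meromorphicAt, h] at hlim
    exact hlim.false
  have hpole := meromorphicOrderAt_logDeriv_eq_neg_one hθ.meromorphicAt horder
    (meromorphicOrderAt_latticeTheta_ne_top hL z)
  have hnonneg := (analyticAt_periodicZeta L hz).meromorphicOrderAt_nonneg
  rw [← meromorphicOrderAt_congr hlogDeriv, hpole] at hnonneg
  exact absurd hnonneg (by decide)

end LatticeTheta

section HeatEquation

lemma jacobiTheta₂_fderiv_one_zero (z : ℂ) {τ : ℂ} (hτ : 0 < τ.im) :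
    jacobiTheta₂_fderiv z τ (1, 0) = jacobiTheta₂' z τ := by
  have h : HasDerivAt (fun x ↦ jacobiTheta₂ x τ) (jacobiTheta₂_fderiv z τ (1, 0)) z :=
    HasFDerivAt.comp_hasDerivAt (f := fun x ↦ (x, τ)) z (hasFDerivAt_jacobiTheta₂ z hτ)
      ((hasDerivAt_id z).prodMk (hasDerivAt_const z τ))
  exact h.unique (hasDerivAt_jacobiTheta₂_fst z hτ)

lemma tsum_sq_mul_jacobiTheta₂_term (z : ℂ) {τ : ℂ} (hτ : 0 < τ.im) :
    ∑' n : ℤ, (2 * Real.pi * I * n) ^ 2 * jacobiTheta₂_term n z τ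
      = 4 * Real.pi * I * jacobiTheta₂_fderiv z τ (0, 1) := by
  have hfderiv := (hasSum_jacobiTheta₂_term_fderiv z hτ).mapL
    (ContinuousLinearMap.apply ℂ ℂ ((0, 1) : ℂ × ℂ))
  refine ((hfderiv.mul_left (4 * Real.pi * I)).congr_fun fun n ↦ ?_).tsum_eq
  simp only [jacobiTheta₂_term_fderiv, jacobiTheta₂_term, ContinuousLinearMap.apply_apply,
    _root_.smul_apply, _root_.add_apply, ContinuousLinearMap.coe_fst', ContinuousLinearMap.coe_snd',
    smul_eq_mul]
  ring

lemma hasDerivAt_jacobiTheta₂' (z : ℂ) {τ : ℂ} (hτ : 0 < τ.im) :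
    HasDerivAt (fun z ↦ jacobiTheta₂' z τ)
      (4 * Real.pi * I * jacobiTheta₂_fderiv z τ (0, 1)) z := by
  obtain ⟨S, hz⟩ := exists_gt |z.im|
  have hopen : IsOpen {u : ℂ | |u.im| < S} := isOpen_lt (by fun_prop) continuous_const
  have hconn : IsPreconnected {u : ℂ | |u.im| < S} := by
    simpa only [abs_lt] using!
      ((convex_halfSpace_im_gt _).inter (convex_halfSpace_im_lt _)).isPreconnected
  have hbound := (summable_pow_mul_jacobiTheta₂_term_bound S hτ 2).mul_left ((2 * Real.pi) ^ 2)
  rw [← tsum_sq_mul_jacobiTheta₂_term z hτ]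
  refine hasDerivAt_tsum_of_isPreconnected (g := fun n z ↦ jacobiTheta₂'_term n z τ)
    (g' := fun n z ↦ (2 * Real.pi * I * n) ^ 2 * jacobiTheta₂_term n z τ) hbound hopen hconn
    (fun n y _ ↦ ?_) (fun n y hy ↦ ?_) hz
    ((summable_jacobiTheta₂'_term_iff z τ).2 hτ) hz
  · have hlin : HasDerivAt (fun y ↦ 2 * Real.pi * I * n * y + Real.pi * I * n ^ 2 * τ)
        (2 * Real.pi * I * n) y := (hasDerivAt_const_mul _).add_const _
    refine (hlin.cexp.const_mul (2 * Real.pi * I * n)).congr_deriv ?_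
    rw [jacobiTheta₂_term]
    ring
  · have hnorm : ‖2 * (Real.pi : ℂ) * I * n‖ = 2 * Real.pi * |n| := by
      simp [abs_of_pos Real.pi_pos]
    rw [norm_mul, norm_pow, hnorm, mul_pow, mul_assoc]
    gcongr
    exact norm_jacobiTheta₂_term_le hτ hy.le le_rfl n

lemma deriv_jacobiThetaOne (v : ℂ) {τ : ℂ} (hτ : 0 < τ.im) :
    deriv (fun v ↦ jacobiThetaOne v τ) v = I * exp (Real.pi * I * (τ / 4 - v))
      * (jacobiTheta₂' (v + 1 / 2 - τ / 2) τ
        - Real.pi * I * jacobiTheta₂ (v + 1 / 2 - τ / 2) τ) := by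
  have hexp := (((hasDerivAt_id v).const_sub (τ / 4)).const_mul (Real.pi * I)).cexp.const_mul I
  have hθ := (hasDerivAt_jacobiTheta₂_fst (v + 1 / 2 - τ / 2) hτ).comp v
    (((hasDerivAt_id v).add_const (1 / 2)).sub_const (τ / 2))
  simp only [jacobiThetaOne_eq]
  refine ((hexp.fun_mul hθ).congr_deriv ?_).deriv
  simp only [id_eq, Function.comp]
  ring

lemma deriv_deriv_jacobiThetaOne (v : ℂ) {τ : ℂ} (hτ : 0 < τ.im) :
    deriv (deriv fun v ↦ jacobiThetaOne v τ) v = I * exp (Real.pi * I * (τ / 4 - v))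
      * (4 * Real.pi * I * jacobiTheta₂_fderiv (v + 1 / 2 - τ / 2) τ (0, 1)
        - 2 * Real.pi * I * jacobiTheta₂' (v + 1 / 2 - τ / 2) τ
        + (Real.pi * I) ^ 2 * jacobiTheta₂ (v + 1 / 2 - τ / 2) τ) := by
  have hshift := ((hasDerivAt_id v).add_const (1 / 2)).sub_const (τ / 2)
  have hexp := (((hasDerivAt_id v).const_sub (τ / 4)).const_mul (Real.pi * I)).cexp.const_mul I
  have hθ := (hasDerivAt_jacobiTheta₂_fst (v + 1 / 2 - τ / 2) hτ).comp v hshift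
  have hθ' := (hasDerivAt_jacobiTheta₂' (v + 1 / 2 - τ / 2) hτ).comp v hshift
  rw [show deriv (fun v ↦ jacobiThetaOne v τ) = _ from funext fun v ↦ deriv_jacobiThetaOne v hτ]
  refine ((hexp.fun_mul (hθ'.fun_sub (hθ.const_mul (Real.pi * I)))).congr_deriv ?_).deriv
  simp only [id_eq, Function.comp]
  ring

lemma hasDerivAt_jacobiThetaOne_tau (v : ℂ) {τ : ℂ} (hτ : 0 < τ.im) :
    HasDerivAt (fun τ ↦ jacobiThetaOne v τ)
      (deriv (deriv fun v ↦ jacobiThetaOne v τ) v / (4 * Real.pi * I)) τ := by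
  have hexp :=
    ((((hasDerivAt_id τ).div_const 4).sub_const v).const_mul (Real.pi * I)).cexp.const_mul I
  have hcurve : HasDerivAt (fun τ : ℂ ↦ (v + 1 / 2 - τ / 2, τ)) (-(1 / 2), 1) τ :=
    (((hasDerivAt_id τ).div_const 2).const_sub (v + 1 / 2)).prodMk (hasDerivAt_id τ)
  have hθ := (hasFDerivAt_jacobiTheta₂ (v + 1 / 2 - τ / 2) hτ).comp_hasDerivAt_of_eq τ hcurve rfl
  have hsplit : ((-(1 / 2), 1) : ℂ × ℂ) = (-(1 / 2) : ℂ) • (1, 0) + (0, 1) := by simp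
  rw [hsplit, map_add, map_smul, jacobiTheta₂_fderiv_one_zero _ hτ] at hθ
  simp only [jacobiThetaOne_eq] at hθ ⊢
  refine (hexp.fun_mul hθ).congr_deriv ?_
  simp only [← jacobiThetaOne_eq]
  rw [deriv_deriv_jacobiThetaOne v hτ]
  have := I_ne_zero
  have := Real.pi_ne_zero
  simp only [id_eq, Function.comp, smul_eq_mul]
  field_simp
  ring

end HeatEquation

section LatticeTheta

variable {L : PeriodPair}

lemma deriv_deriv_latticeTheta (hL : 0 < (L.ω₂ / L.ω₁).im) {z : ℂ} (hz : z ∉ L.lattice) :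
    deriv (deriv (latticeTheta L)) z = latticeTheta L z
      * (periodicZeta L z ^ 2 - (L.weierstrassP z + 2 * L.etaOne / L.ω₁)) := by
  have hderiv : deriv (latticeTheta L) =ᶠ[𝓝 z] fun w ↦ latticeTheta L w * periodicZeta L w := by
    filter_upwards [L.isClosed_lattice.isOpen_compl.mem_nhds hz] with w hw
    exact (hasDerivAt_latticeTheta hL hw).deriv
  rw [hderiv.deriv_eq,
    ((hasDerivAt_latticeTheta hL hz).fun_mul (hasDerivAt_periodicZeta L hz)).deriv]
  ring

variable (L) in
lemma deriv_deriv_latticeTheta_eq_div (z : ℂ) :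
    deriv (deriv (latticeTheta L)) z
      = deriv (deriv fun v ↦ jacobiThetaOne v (L.ω₂ / L.ω₁)) (z / L.ω₁) / L.ω₁ ^ 2 := by
  have hscale : latticeTheta L = fun z ↦ jacobiThetaOne (L.ω₁⁻¹ * z) (L.ω₂ / L.ω₁) := by
    funext z
    rw [latticeTheta, div_eq_inv_mul]
  have hderiv : deriv (latticeTheta L)
      = fun z ↦ L.ω₁⁻¹ * deriv (fun v ↦ jacobiThetaOne v (L.ω₂ / L.ω₁)) (L.ω₁⁻¹ * z) := by
    funext z
    rw [hscale, deriv_comp_mul_left L.ω₁⁻¹ fun v ↦ jacobiThetaOne v (L.ω₂ / L.ω₁), smul_eq_mul]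
  rw [hderiv, deriv_const_mul_field,
    deriv_comp_mul_left L.ω₁⁻¹ (deriv fun v ↦ jacobiThetaOne v (L.ω₂ / L.ω₁)), smul_eq_mul]
  ring_nf

end LatticeTheta

section ThetaPotential

lemma exists_hasDerivAt_of_hasDerivAt_ofReal {f : ℝ → ℝ} {f' : ℂ} {x : ℝ}
    (h : HasDerivAt (fun y ↦ (f y : ℂ)) f' x) : ∃ d : ℝ, (d : ℂ) = f' ∧ HasDerivAt f d x := by
  have hre : HasDerivAt f f'.re x := by
    simpa using! reCLM.hasFDerivAt.comp_hasDerivAt x h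
  exact ⟨f'.re, hre.ofReal_comp.unique h, hre⟩

lemma hasDerivAt_deriv_of_contDiffAt_two {f : ℝ → ℝ} {x : ℝ} (hf : ContDiffAt ℝ 2 f x) :
    HasDerivAt (deriv f) (deriv (deriv f) x) x :=
  ((hf.derivWithin (m := 1) (by norm_num)).differentiableAt (by simp)).hasDerivAt

/-- The real theta function `x ↦ ϑ₁(x / (2πr); N τ(t))`, of which `thetaPotential` is the negative
logarithm. -/
def realTheta (N : ℕ) (r T t x : ℝ) : ℝ :=
  (jacobiThetaOne (x / (2 * Real.pi * r) : ℝ)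
    (I * (N * (T - t) / (2 * Real.pi * r ^ 2) : ℝ))).re

lemma ofReal_realTheta (N : ℕ) (r T t x : ℝ) :
    (realTheta N r T t x : ℂ) = jacobiThetaOne (x / (2 * Real.pi * r) : ℝ)
      (I * (N * (T - t) / (2 * Real.pi * r ^ 2) : ℝ)) :=
  conj_eq_iff_re.1 (jacobiThetaOne_conj _ _)

lemma thetaPotential_neg (N : ℕ) (r T t x : ℝ) :
    thetaPotential N r T t (-x) = thetaPotential N r T t x := by
  rw [thetaPotential, neg_div, ofReal_neg, jacobiThetaOne_neg, neg_re, Real.log_neg_eq_log,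
    thetaPotential]

lemma thetaPotential'_neg (N : ℕ) (r T t x : ℝ) :
    thetaPotential' N r T t (-x) = -thetaPotential' N r T t x := by
  have h := deriv_comp_neg (thetaPotential N r T t) x
  simp only [thetaPotential_neg] at h
  rw [thetaPotential', thetaPotential', h, neg_neg]

lemma thetaPotential''_neg (N : ℕ) (r T t x : ℝ) :
    thetaPotential'' N r T t (-x) = thetaPotential'' N r T t x := by
  have h := deriv_comp_neg (thetaPotential' N r T t) x
  simp only [thetaPotential'_neg, deriv.fun_neg] at h
  exact (neg_injective h).symm

variable {N : ℕ} {r T t : ℝ} (hN : 2 ≤ N) (hr : 0 < r) (ht : t < T)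

lemma dysonPeriods_ω₁ : (dysonPeriods hN hr ht).ω₁ = (2 * Real.pi * r : ℝ) := rfl

lemma dysonPeriods_ω₂_div_ω₁ : (dysonPeriods hN hr ht).ω₂ / (dysonPeriods hN hr ht).ω₁
    = I * (N * (T - t) / (2 * Real.pi * r ^ 2) : ℝ) := by
  simp only [dysonPeriods]
  push_cast
  field

include hN hr ht in
lemma thetaModulus_im_pos : 0 < (I * (N * (T - t) / (2 * Real.pi * r ^ 2) : ℝ) : ℂ).im := by
  have : (0 : ℝ) < N := by exact_mod_cast two_pos.trans_le hN
  have : 0 < T - t := sub_pos.2 ht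
  rw [I_mul_im, ofReal_re]
  positivity

lemma dysonPeriods_im_pos :
    0 < ((dysonPeriods hN hr ht).ω₂ / (dysonPeriods hN hr ht).ω₁).im := by
  rw [dysonPeriods_ω₂_div_ω₁]
  exact thetaModulus_im_pos hN hr ht

lemma two_mul_etaOne_div_ω₁ :
    2 * (dysonPeriods hN hr ht).etaOne / (dysonPeriods hN hr ht).ω₁
      = 1 / (Real.pi * r) * (dysonPeriods hN hr ht).etaOne := by
  rw [dysonPeriods_ω₁]
  push_cast
  field

lemma ofReal_etaOne_re :
    ((dysonPeriods hN hr ht).etaOne.re : ℂ) = (dysonPeriods hN hr ht).etaOne :=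
  conj_eq_iff_re.1 (etaOne_dysonPeriods_conj hN hr ht)

lemma ofReal_notMem_lattice {x : ℝ} (hx : ∀ m : ℤ, x ≠ 2 * Real.pi * r * m) :
    (x : ℂ) ∉ (dysonPeriods hN hr ht).lattice := by
  intro h
  obtain ⟨m, n, h⟩ := PeriodPair.mem_lattice.1 h
  have hre := congrArg Complex.re h
  exact hx m (by simpa [dysonPeriods, mul_comm] using hre.symm)

lemma ofReal_realTheta_eq_latticeTheta (x : ℝ) :
    (realTheta N r T t x : ℂ) = latticeTheta (dysonPeriods hN hr ht) x := by
  rw [ofReal_realTheta, latticeTheta, dysonPeriods_ω₂_div_ω₁, dysonPeriods_ω₁, ofReal_div]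

section Derivatives

variable {x : ℝ} (hx : (x : ℂ) ∉ (dysonPeriods hN hr ht).lattice)

include hx

lemma realTheta_ne_zero : realTheta N r T t x ≠ 0 := by
  rw [← ofReal_ne_zero, ofReal_realTheta_eq_latticeTheta hN hr ht]
  exact latticeTheta_ne_zero (dysonPeriods_im_pos hN hr ht) hx

lemma contDiffAt_thetaPotential {n : WithTop ℕ∞} : ContDiffAt ℝ n (thetaPotential N r T t) x := by
  have hθ : ContDiff ℝ n (realTheta N r T t) := by
    have heq : realTheta N r T t = fun y : ℝ ↦ (latticeTheta (dysonPeriods hN hr ht) y).re := by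
      funext y
      rw [← ofReal_realTheta_eq_latticeTheta, ofReal_re]
    rw [heq]
    exact reCLM.contDiff.comp ((((differentiable_latticeTheta
      (dysonPeriods_im_pos hN hr ht)).contDiff (n := n)).restrict_scalars ℝ).comp
        ofRealCLM.contDiff)
  exact (hθ.contDiffAt.log (realTheta_ne_zero hN hr ht hx)).neg

lemma hasDerivAt_thetaPotential :
    HasDerivAt (thetaPotential N r T t) (thetaPotential' N r T t x) x :=
  ((contDiffAt_thetaPotential hN hr ht hx (n := 1)).differentiableAt one_ne_zero).hasDerivAt

lemma hasDerivAt_thetaPotential' :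
    HasDerivAt (thetaPotential' N r T t) (thetaPotential'' N r T t x) x :=
  hasDerivAt_deriv_of_contDiffAt_two (contDiffAt_thetaPotential hN hr ht hx)

lemma ofReal_thetaPotential' :
    (thetaPotential' N r T t x : ℂ) = -periodicZeta (dysonPeriods hN hr ht) x := by
  have hθ := (hasDerivAt_latticeTheta (dysonPeriods_im_pos hN hr ht) hx).comp_ofReal
  simp only [← ofReal_realTheta_eq_latticeTheta] at hθ
  obtain ⟨d, hd, hderiv⟩ := exists_hasDerivAt_of_hasDerivAt_ofReal hθ
  have hθ₀ := realTheta_ne_zero hN hr ht hx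
  have hlog : thetaPotential' N r T t x = -(d / realTheta N r T t x) := (hderiv.log hθ₀).neg.deriv
  rw [hlog, ofReal_neg, ofReal_div, hd, mul_div_cancel_left₀ _ (ofReal_ne_zero.2 hθ₀)]

lemma ofReal_thetaPotential'' :
    (thetaPotential'' N r T t x : ℂ) = (dysonPeriods hN hr ht).weierstrassP x
      + 1 / (Real.pi * r) * (dysonPeriods hN hr ht).etaOne := by
  have hζ := (hasDerivAt_periodicZeta _ hx).comp_ofReal.fun_neg
  rw [neg_neg, two_mul_etaOne_div_ω₁] at hζ
  refine (hasDerivAt_thetaPotential' hN hr ht hx).ofReal_comp.unique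
    (hζ.congr_of_eventuallyEq ?_)
  filter_upwards [continuous_ofReal.continuousAt.eventually
    ((dysonPeriods hN hr ht).isClosed_lattice.isOpen_compl.mem_nhds hx)] with y hy
  exact ofReal_thetaPotential' hN hr ht hy

lemma hasDerivAt_realTheta_time :
    HasDerivAt (fun s ↦ realTheta N r T s x) (-(N / 2) * (realTheta N r T t x
      * (thetaPotential' N r T t x ^ 2 - thetaPotential'' N r T t x))) t := by
  have hmodulus : HasDerivAt (fun s : ℝ ↦ N * (T - s) / (2 * Real.pi * r ^ 2))
      (N * (-1) / (2 * Real.pi * r ^ 2)) t :=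
    (((hasDerivAt_id t).const_sub T).const_mul _).div_const _
  have hτ := thetaModulus_im_pos hN hr ht
  have hθ := (hasDerivAt_jacobiThetaOne_tau ((x / (2 * Real.pi * r) : ℝ) : ℂ) hτ).comp t
    (hmodulus.ofReal_comp.const_mul I)
  simp only [Function.comp_def, ← ofReal_realTheta] at hθ
  obtain ⟨d, hd, hderiv⟩ := exists_hasDerivAt_of_hasDerivAt_ofReal hθ
  have hspace := deriv_deriv_latticeTheta (dysonPeriods_im_pos hN hr ht) hx
  rw [deriv_deriv_latticeTheta_eq_div, dysonPeriods_ω₂_div_ω₁, two_mul_etaOne_div_ω₁,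
    dysonPeriods_ω₁, ← ofReal_thetaPotential'' hN hr ht hx, ← neg_sq (periodicZeta _ _),
    ← ofReal_thetaPotential' hN hr ht hx, ← ofReal_realTheta_eq_latticeTheta, ← ofReal_div,
    div_eq_iff (by simp [Real.pi_ne_zero, hr.ne'])] at hspace
  rw [hspace] at hd
  refine hderiv.congr_deriv (ofReal_injective ?_)
  rw [hd]
  have := I_ne_zero
  have := ofReal_ne_zero.2 hr.ne'
  push_cast
  field

lemma hasDerivAt_thetaPotential_time :
    HasDerivAt (fun s ↦ thetaPotential N r T s x)
      (N / 2 * (thetaPotential' N r T t x ^ 2 - thetaPotential'' N r T t x)) t := by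
  have hθ₀ := realTheta_ne_zero hN hr ht hx
  refine ((hasDerivAt_realTheta_time hN hr ht hx).log hθ₀).neg.congr_deriv ?_
  field

end Derivatives

lemma thetaPotential'_addition {a b : ℝ} (ha : (a : ℂ) ∉ (dysonPeriods hN hr ht).lattice)
    (hb : (b : ℂ) ∉ (dysonPeriods hN hr ht).lattice)
    (hab : ((a + b : ℝ) : ℂ) ∉ (dysonPeriods hN hr ht).lattice) :
    (thetaPotential' N r T t a + thetaPotential' N r T t b - thetaPotential' N r T t (a + b)) ^ 2
      = thetaPotential'' N r T t a + thetaPotential'' N r T t b + thetaPotential'' N r T t (a + b)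
        - 3 * (1 / (Real.pi * r) * (dysonPeriods hN hr ht).etaOne.re) := by
  have hadd := periodicZeta_addition _ ha hb (by exact_mod_cast hab)
  refine ofReal_injective ?_
  push_cast
  rw [ofReal_thetaPotential' hN hr ht ha, ofReal_thetaPotential' hN hr ht hb,
    ofReal_thetaPotential' hN hr ht hab, ofReal_thetaPotential'' hN hr ht ha,
    ofReal_thetaPotential'' hN hr ht hb, ofReal_thetaPotential'' hN hr ht hab,
    ofReal_etaOne_re, ofReal_add]
  linear_combination hadd

end ThetaPotential

end

section

open Filter Topology Finset

section PairSums

variable {ι R : Type*}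

lemma sum_sum_sum_rotate [Fintype ι] [AddCommMonoid R] (f : ι → ι → ι → R) :
    ∑ j, ∑ k, ∑ l, f k l j = ∑ j, ∑ k, ∑ l, f j k l := by
  rw [sum_comm]
  exact sum_congr rfl fun k _ ↦ sum_comm

lemma sum_sum_sum_eq_of_cyclic [Fintype ι] [Field R] [CharZero R] {f g : ι → ι → ι → R}
    (h : ∀ j k l, f j k l + f k l j + f l j k = g j k l + g k l j + g l j k) :
    ∑ j, ∑ k, ∑ l, f j k l = ∑ j, ∑ k, ∑ l, g j k l := by
  have hsum : ∑ j, ∑ k, ∑ l, (f j k l + f k l j + f l j k)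
      = ∑ j, ∑ k, ∑ l, (g j k l + g k l j + g l j k) := by simp only [h]
  have hrotate (f : ι → ι → ι → R) : ∑ j, ∑ k, ∑ l, f l j k = ∑ j, ∑ k, ∑ l, f j k l :=
    (sum_sum_sum_rotate fun j k l ↦ f l j k).symm
  simp only [sum_add_distrib] at hsum
  rw [sum_sum_sum_rotate f, sum_sum_sum_rotate g, hrotate f, hrotate g] at hsum
  linear_combination hsum / 3

lemma cyclic_mul_of_addition [Field R] [CharZero R] [DecidableEq ι] {A C : ι → ι → R}
    (hA : ∀ j k, A j k = -A k j) (hC : ∀ j k, C j k = C k j) (hC₀ : ∀ j, C j j = 0)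
    (hadd : ∀ j k l, j ≠ k → k ≠ l → l ≠ j → (A j k + A k l + A l j) ^ 2 = C j k + C k l + C l j)
    (j k l : ι) :
    A j k * A j l + A k l * A k j + A l j * A l k
      = (A j k ^ 2 - C j k) / 2 + (if j = k then C l j else 0)
        + ((A k l ^ 2 - C k l) / 2 + if k = l then C j k else 0)
        + ((A l j ^ 2 - C l j) / 2 + if l = j then C k l else 0) := by
  have hA₀ (j : ι) : A j j = 0 := self_eq_neg.1 (hA j j)
  rw [hA k j, hA l k, hA l j]
  by_cases hjk : j = k
  · subst hjk
    by_cases hlj : l = j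
    · simp [hA₀, hC₀, hlj]
    · simp only [hA₀, hC₀, hC j l, hlj, Ne.symm hlj, if_true, if_false]
      ring
  by_cases hkl : k = l
  · subst hkl
    simp only [hA₀, hC₀, hC j k, hjk, Ne.symm hjk, if_true, if_false]
    ring
  by_cases hlj : l = j
  · subst hlj
    simp only [hA₀, hC₀, hC k l, hA k l, hjk, hkl, if_true, if_false]
    ring
  have h := hadd j k l hjk hkl hlj
  rw [hA l j] at h
  simp only [hjk, hkl, hlj, if_false]
  linear_combination -h / 2

lemma sum_sq_sum_of_addition [Fintype ι] [DecidableEq ι] [Field R] [CharZero R] {A C : ι → ι → R}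
    (hA : ∀ j k, A j k = -A k j) (hC : ∀ j k, C j k = C k j)
    (hadd : ∀ j k l, j ≠ k → k ≠ l → l ≠ j →
      (A j k + A k l + A l j) ^ 2 = C j k + C k l + C l j) :
    ∑ j, (∑ k ∈ {j}ᶜ, A j k) ^ 2
      = Fintype.card ι / 2 * ∑ j, ∑ k ∈ {j}ᶜ, A j k ^ 2
        - (Fintype.card ι - 2) / 2 * ∑ j, ∑ k ∈ {j}ᶜ, C j k := by
  have hA₀ (j : ι) : A j j = 0 := self_eq_neg.1 (hA j j)
  let B (j k : ι) : R := if j = k then 0 else C j k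
  have hB (j k : ι) : B j k = B k j := by simp only [B, hC j k, eq_comm]
  have hcyclic : ∑ j, ∑ k, ∑ l, A j k * A j l
      = ∑ j, ∑ k, ∑ l, ((A j k ^ 2 - B j k) / 2 + if j = k then B l j else 0) :=
    sum_sum_sum_eq_of_cyclic <| cyclic_mul_of_addition hA hB (fun j ↦ if_pos rfl)
      fun j k l hjk hkl hlj ↦ by
        simpa only [B, hjk, hkl, hlj, if_false] using hadd j k l hjk hkl hlj
  have hcoincide : ∑ j, ∑ k, ∑ l, (if j = k then B l j else 0) = ∑ j, ∑ k, B j k := by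
    simp only [sum_comm (s := univ) (t := univ) (f := fun _ _ ↦ ite _ _ _), sum_ite_eq, mem_univ,
      if_true, fun j l ↦ hB l j]
  have hsumA (j : ι) : ∑ k ∈ {j}ᶜ, A j k = ∑ k, A j k := by
    rw [Fintype.sum_eq_add_sum_compl j, hA₀, zero_add]
  have hsumA₂ (j : ι) : ∑ k ∈ {j}ᶜ, A j k ^ 2 = ∑ k, A j k ^ 2 := by
    rw [Fintype.sum_eq_add_sum_compl j, hA₀, sq, mul_zero, zero_add]
  have hsumC (j : ι) : ∑ k ∈ {j}ᶜ, C j k = ∑ k, B j k := by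
    rw [Fintype.sum_eq_add_sum_compl j]
    simp only [B, if_true, zero_add]
    exact sum_congr rfl fun k hk ↦ (if_neg fun h ↦ by simp [h] at hk).symm
  simp only [hsumA, hsumA₂, hsumC]
  simp only [sq (∑ k, A _ k), sum_mul_sum]
  rw [hcyclic]
  simp only [sum_add_distrib, hcoincide, sum_const, card_univ, nsmul_eq_mul, ← mul_sum, ← sum_div,
    sum_sub_distrib]
  ring

variable {N : ℕ}

lemma two_mul_sum_sum_Ioi [Semiring R] {f : Fin N → Fin N → R} (hf : ∀ i k, f i k = f k i) :
    2 * ∑ i, ∑ k ∈ Ioi i, f k i = ∑ i, ∑ k ∈ {i}ᶜ, f i k := by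
  rw [← sum_sum_Ioi_add_eq_sum_sum_off_diag fun k i ↦ f i k]
  simp only [hf, ← two_mul, mul_sum]

lemma sum_sum_Ioi_mul_single_sub [Ring R] {f : Fin N → Fin N → R} (hf : ∀ i k, f i k = -f k i)
    (j : Fin N) :
    ∑ i, ∑ k ∈ Ioi i, f k i * ((Pi.single j 1 : Fin N → R) k - (Pi.single j 1 : Fin N → R) i)
      = ∑ k ∈ {j}ᶜ, f j k := by
  have h := sum_sum_Ioi_add_eq_sum_sum_off_diag fun k i ↦ f i k * (Pi.single j 1 : Fin N → R) i
  have hrhs : ∑ i, ∑ k ∈ {i}ᶜ, f i k * (Pi.single j 1 : Fin N → R) i = ∑ k ∈ {j}ᶜ, f j k := by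
    simp [Pi.single_apply]
  rw [← hrhs, ← h]
  refine sum_congr rfl fun i _ ↦ sum_congr rfl fun k _ ↦ ?_
  rw [hf i k, mul_sub, neg_mul, sub_eq_neg_add]

lemma sum_sum_Ioi_one [Field R] [CharZero R] :
    ∑ i : Fin N, ∑ _k ∈ Ioi i, (1 : R) = N * (N - 1) / 2 := by
  rw [eq_div_iff two_ne_zero, mul_comm, two_mul_sum_sum_Ioi fun _ _ ↦ rfl]
  cases N <;> simp [card_compl]

end PairSums

section CoordDeriv

lemma exp_mul_exp_neg_mul_div_two (β w : ℝ) :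
    Real.exp (β * w / 2) * Real.exp (-β * w / 2) = 1 := by
  rw [← Real.exp_add, neg_mul, neg_div, add_neg_cancel, Real.exp_zero]

lemma exp_mul_deriv_conj {β a : ℝ} {w h : ℝ → ℝ} (hw : ContDiffAt ℝ 2 w a)
    (hh : ContDiffAt ℝ 2 h a) :
    Real.exp (β * w a / 2) * (1 / 2 * deriv (deriv fun s ↦ Real.exp (-β * w s / 2) * h s) a
        + β / 2 * deriv (fun s ↦ deriv w s * (Real.exp (-β * w s / 2) * h s)) a)
      = 1 / 2 * deriv (deriv h) a
        + (β / 4 * deriv (deriv w) a - β ^ 2 / 8 * deriv w a ^ 2) * h a := by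
  have hexp {s : ℝ} (hs : ContDiffAt ℝ 2 w s) : HasDerivAt (fun s ↦ Real.exp (-β * w s / 2))
      (Real.exp (-β * w s / 2) * (-β * deriv w s / 2)) s :=
    (((hs.differentiableAt two_ne_zero).hasDerivAt.const_mul (-β)).div_const 2).exp
  have hw₂ := hasDerivAt_deriv_of_contDiffAt_two hw
  have hh₁ := (hh.differentiableAt two_ne_zero).hasDerivAt
  have hfst : deriv (fun s ↦ Real.exp (-β * w s / 2) * h s) =ᶠ[𝓝 a]
      fun s ↦ Real.exp (-β * w s / 2) * (deriv h s - β / 2 * deriv w s * h s) := by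
    filter_upwards [hw.eventually (by simp), hh.eventually (by simp)] with s hws hhs
    rw [((hexp hws).fun_mul (hhs.differentiableAt two_ne_zero).hasDerivAt).deriv]
    ring
  rw [hfst.deriv_eq, ((hexp hw).fun_mul ((hasDerivAt_deriv_of_contDiffAt_two hh).fun_sub
    ((hw₂.const_mul (β / 2)).fun_mul hh₁))).deriv,
    (hw₂.fun_mul ((hexp hw).fun_mul hh₁)).deriv]
  linear_combination (1 / 2 * deriv (deriv h) a
    + (β / 4 * deriv (deriv w) a - β ^ 2 / 8 * deriv w a ^ 2) * h a)
      * exp_mul_exp_neg_mul_div_two β (w a)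

variable {N : ℕ} {x : Fin N → ℝ}

lemma coordDeriv_update (j : Fin N) (f : (Fin N → ℝ) → ℝ) (x : Fin N → ℝ) (s : ℝ) :
    coordDeriv j f (Function.update x j s) = deriv (fun s ↦ f (Function.update x j s)) s := by
  simp only [coordDeriv, Function.update_idem, Function.update_self]

lemma coordDeriv_coordDeriv (j : Fin N) (f : (Fin N → ℝ) → ℝ) (x : Fin N → ℝ) :
    coordDeriv j (coordDeriv j f) x = deriv (deriv fun s ↦ f (Function.update x j s)) (x j) := by
  rw [coordDeriv]
  simp only [coordDeriv_update]

lemma contDiffAt_comp_update {n : WithTop ℕ∞} {f : (Fin N → ℝ) → ℝ} (hf : ContDiffAt ℝ n f x)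
    (j : Fin N) : ContDiffAt ℝ n (fun s ↦ f (Function.update x j s)) (x j) :=
  ContDiffAt.comp (x j) (by rwa [Function.update_eq_self]) (contDiff_update n x j).contDiffAt

lemma eventually_update_nhds {p : (Fin N → ℝ) → Prop} (hp : ∀ᶠ y in 𝓝 x, p y) (j : Fin N) :
    ∀ᶠ s in 𝓝 (x j), p (Function.update x j s) := by
  have hcont : ContinuousAt (fun s ↦ Function.update x j s) (x j) :=
    (continuous_const.update j continuous_id).continuousAt
  exact hcont.eventually (by simpa only [Function.update_eq_self] using hp)

lemma exp_mul_coordDeriv_conj (β : ℝ) (j : Fin N) {w f : (Fin N → ℝ) → ℝ}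
    (hw : ContDiffAt ℝ 2 w x) (hf : ContDiffAt ℝ 2 f x) :
    Real.exp (β * w x / 2) * (1 / 2 * coordDeriv j (coordDeriv j
          fun y ↦ Real.exp (-β * w y / 2) * f y) x
        + β / 2 * coordDeriv j (fun y ↦ coordDeriv j w y * (Real.exp (-β * w y / 2) * f y)) x)
      = 1 / 2 * coordDeriv j (coordDeriv j f) x
        + (β / 4 * coordDeriv j (coordDeriv j w) x - β ^ 2 / 8 * coordDeriv j w x ^ 2) * f x := by
  have h := exp_mul_deriv_conj (β := β) (contDiffAt_comp_update hw j) (contDiffAt_comp_update hf j)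
  simp only [Function.update_eq_self] at h
  rw [coordDeriv_coordDeriv, coordDeriv_coordDeriv, coordDeriv_coordDeriv, coordDeriv, coordDeriv]
  simpa only [coordDeriv_update] using h

lemma hasDerivAt_update_apply (x : Fin N → ℝ) (j k : Fin N) (s : ℝ) :
    HasDerivAt (fun s ↦ Function.update x j s k) ((Pi.single j 1 : Fin N → ℝ) k) s :=
  hasDerivAt_pi.1 (hasDerivAt_update x j s) k

lemma hasDerivAt_shiftedSum_update (r : ℝ) (x : Fin N → ℝ) (j : Fin N) (s : ℝ) :
    HasDerivAt (fun s ↦ shiftedSum r (Function.update x j s)) 1 s := by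
  refine ((HasDerivAt.fun_sum (u := univ) fun k _ ↦
    hasDerivAt_update_apply x j k s).sub_const (kappaShift N r)).congr_deriv ?_
  simp

end CoordDeriv

section RegularConfigurations

lemma isOpen_regularConfigurations (N : ℕ) {r : ℝ} (hr : 0 < r) :
    IsOpen (regularConfigurations N r) := by
  have hclosed : IsClosed (Set.range fun m : ℤ ↦ 2 * Real.pi * r * m) :=
    ((Homeomorph.mulLeft₀ (2 * Real.pi * r) (by positivity)).isClosedEmbedding.comp
      Int.isClosedEmbedding_coe_real).isClosed_range
  have heq : regularConfigurations N r = (⋂ j, ⋂ k, ⋂ (_ : j < k),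
      (fun x : Fin N → ℝ ↦ x k - x j) ⁻¹' (Set.range fun m : ℤ ↦ 2 * Real.pi * r * m)ᶜ)
      ∩ shiftedSum r ⁻¹' (Set.range fun m : ℤ ↦ 2 * Real.pi * r * m)ᶜ := by
    ext x
    simp [regularConfigurations, eq_comm]
  have hsum : Continuous (shiftedSum (N := N) r) := by
    unfold shiftedSum
    fun_prop
  rw [heq]
  exact (isOpen_iInter_of_finite fun j ↦ isOpen_iInter_of_finite fun k ↦
    isOpen_iInter_of_finite fun _ ↦ hclosed.isOpen_compl.preimage (by fun_prop)).inter
      (hclosed.isOpen_compl.preimage hsum)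

variable {N : ℕ} {r T t β : ℝ} (hN : 2 ≤ N) (hr : 0 < r) (ht : t < T) {x : Fin N → ℝ}
  (hx : x ∈ regularConfigurations N r)

include hx in
lemma sub_notMem_lattice {j k : Fin N} (hjk : j ≠ k) :
    ((x j - x k : ℝ) : ℂ) ∉ (dysonPeriods hN hr ht).lattice := by
  rcases hjk.lt_or_gt with hlt | hlt
  · intro hmem
    exact ofReal_notMem_lattice hN hr ht (hx.1 j k hlt) (by simpa using neg_mem hmem)
  · exact ofReal_notMem_lattice hN hr ht (hx.1 k j hlt)

include hx in
lemma shiftedSum_notMem_lattice :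
    ((shiftedSum r x : ℝ) : ℂ) ∉ (dysonPeriods hN hr ht).lattice :=
  ofReal_notMem_lattice hN hr ht hx.2

include hN hr ht hx

lemma contDiffAt_dysonPotential {n : WithTop ℕ∞} : ContDiffAt ℝ n (dysonPotential r T t) x := by
  refine (ContDiffAt.sum fun j _ ↦ ContDiffAt.sum fun k hk ↦ ?_).add ?_
  · exact (contDiffAt_thetaPotential hN hr ht
      (sub_notMem_lattice hN hr ht hx (mem_Ioi.1 hk).ne')).comp x
        (f := fun x : Fin N → ℝ ↦ x k - x j) (by fun_prop)
  · refine (contDiffAt_thetaPotential hN hr ht (shiftedSum_notMem_lattice hN hr ht hx)).comp x ?_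
    unfold shiftedSum
    fun_prop

lemma exp_mul_kolmogorovOp_conj {f : (Fin N → ℝ) → ℝ} (hf : ContDiffAt ℝ 2 f x) :
    Real.exp (β * dysonPotential r T t x / 2) * kolmogorovOp β r T t
        (fun y ↦ Real.exp (-β * dysonPotential r T t y / 2) * f y) x
      = 1 / 2 * ∑ j, coordDeriv j (coordDeriv j f) x
        + (β / 4 * ∑ j, coordDeriv j (coordDeriv j (dysonPotential r T t)) x
          - β ^ 2 / 8 * ∑ j, coordDeriv j (dysonPotential r T t) x ^ 2) * f x := by
  have hconj (j : Fin N) := exp_mul_coordDeriv_conj β j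
    (contDiffAt_dysonPotential hN hr ht hx) hf
  simp only [kolmogorovOp, mul_sum, ← sum_add_distrib, ← sum_sub_distrib, sum_mul]
  refine sum_congr rfl fun j _ ↦ ?_
  rw [← hconj, mul_add]

lemma coordDeriv_dysonPotential (j : Fin N) :
    coordDeriv j (dysonPotential r T t) x = ∑ k ∈ {j}ᶜ, thetaPotential' N r T t (x j - x k)
      + thetaPotential' N r T t (shiftedSum r x) := by
  have hpair {i k : Fin N} (hk : k ∈ Ioi i) :
      HasDerivAt
        (fun s ↦ thetaPotential N r T t (Function.update x j s k - Function.update x j s i))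
        (thetaPotential' N r T t (x k - x i)
          * ((Pi.single j 1 : Fin N → ℝ) k - (Pi.single j 1 : Fin N → ℝ) i)) (x j) :=
    (hasDerivAt_thetaPotential hN hr ht
      (sub_notMem_lattice hN hr ht hx (mem_Ioi.1 hk).ne')).comp_of_eq (x j)
        ((hasDerivAt_update_apply x j k (x j)).fun_sub (hasDerivAt_update_apply x j i (x j)))
        (by simp)
  have hcenter : HasDerivAt (fun s ↦ thetaPotential N r T t (shiftedSum r (Function.update x j s)))
      (thetaPotential' N r T t (shiftedSum r x) * 1) (x j) :=
    (hasDerivAt_thetaPotential hN hr ht (shiftedSum_notMem_lattice hN hr ht hx)).comp_of_eq (x j)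
      (hasDerivAt_shiftedSum_update r x j (x j)) (by simp)
  have hpairs := sum_sum_Ioi_mul_single_sub
    (f := fun i k ↦ thetaPotential' N r T t (x i - x k))
    (fun i k ↦ by rw [← thetaPotential'_neg, neg_sub]) j
  simp only [coordDeriv, dysonPotential]
  rw [((HasDerivAt.fun_sum (u := univ) fun i _ ↦ HasDerivAt.fun_sum (u := Ioi i)
    fun k hk ↦ hpair hk).fun_add hcenter).deriv, hpairs, mul_one]

lemma coordDeriv_coordDeriv_dysonPotential (j : Fin N) :
    coordDeriv j (coordDeriv j (dysonPotential r T t)) x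
      = ∑ k ∈ {j}ᶜ, thetaPotential'' N r T t (x j - x k)
        + thetaPotential'' N r T t (shiftedSum r x) := by
  have hgrad : (fun s ↦ coordDeriv j (dysonPotential r T t) (Function.update x j s)) =ᶠ[𝓝 (x j)]
      fun s ↦ ∑ k ∈ {j}ᶜ, thetaPotential' N r T t (s - x k)
        + thetaPotential' N r T t (shiftedSum r (Function.update x j s)) := by
    filter_upwards [eventually_update_nhds
      ((isOpen_regularConfigurations N hr).eventually_mem hx) j] with s hs
    rw [coordDeriv_dysonPotential hN hr ht hs, Function.update_self]
    congr 1
    refine sum_congr rfl fun k hk ↦ ?_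
    rw [Function.update_of_ne (by simpa using hk)]
  have hpair {k : Fin N} (hk : k ∈ ({j} : Finset (Fin N))ᶜ) :=
    (hasDerivAt_thetaPotential' hN hr ht (sub_notMem_lattice hN hr ht hx (j := j) (k := k)
      (by simpa [eq_comm] using hk))).comp_sub_const (x j) (x k)
  have hcenter :=
    (hasDerivAt_thetaPotential' hN hr ht (shiftedSum_notMem_lattice hN hr ht hx)).comp_of_eq (x j)
      (hasDerivAt_shiftedSum_update r x j (x j)) (by simp)
  rw [mul_one] at hcenter
  exact hgrad.deriv_eq.trans ((HasDerivAt.fun_sum fun k hk ↦ hpair hk).add hcenter).deriv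

lemma hasDerivAt_dysonPotential_time :
    HasDerivAt (fun s ↦ dysonPotential r T s x) (N / 2 *
      (∑ j, ∑ k ∈ Ioi j, thetaPotential' N r T t (x k - x j) ^ 2
        - ∑ j, ∑ k ∈ Ioi j, thetaPotential'' N r T t (x k - x j)
        + (thetaPotential' N r T t (shiftedSum r x) ^ 2
          - thetaPotential'' N r T t (shiftedSum r x)))) t := by
  simp only [mul_add, ← sum_sub_distrib, mul_sum]
  exact (HasDerivAt.fun_sum fun j _ ↦ HasDerivAt.fun_sum fun k hk ↦
    hasDerivAt_thetaPotential_time hN hr ht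
      (sub_notMem_lattice hN hr ht hx (mem_Ioi.1 hk).ne')).add
    (hasDerivAt_thetaPotential_time hN hr ht (shiftedSum_notMem_lattice hN hr ht hx))

end RegularConfigurations

section Conjugation

lemma thetaPotential'_sub_comm (N : ℕ) (r T t x y : ℝ) :
    thetaPotential' N r T t (x - y) = -thetaPotential' N r T t (y - x) := by
  rw [← thetaPotential'_neg, neg_sub]

lemma thetaPotential''_sub_comm (N : ℕ) (r T t x y : ℝ) :
    thetaPotential'' N r T t (x - y) = thetaPotential'' N r T t (y - x) := by
  rw [← thetaPotential''_neg, neg_sub]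

variable {N : ℕ} {r T t : ℝ} (hN : 2 ≤ N) (hr : 0 < r) (ht : t < T)

lemma ofReal_groundEnergy (β : ℝ) :
    (groundEnergy β hN hr ht : ℂ) = -((β : ℂ) ^ 2 / 16) * N * ((N : ℂ) - 1) * ((N : ℂ) - 2)
      * (1 / ((Real.pi : ℂ) * r)) * (dysonPeriods hN hr ht).etaOne := by
  rw [← ofReal_etaOne_re, groundEnergy]
  push_cast
  rfl

variable {x : Fin N → ℝ} (hx : x ∈ regularConfigurations N r)

include hx

lemma sum_sq_sum_thetaPotential' :
    ∑ j, (∑ k ∈ {j}ᶜ, thetaPotential' N r T t (x j - x k)) ^ 2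
      = N * ∑ j, ∑ k ∈ Ioi j, thetaPotential' N r T t (x k - x j) ^ 2
        - (N - 2) * ∑ j, ∑ k ∈ Ioi j, thetaPotential'' N r T t (x k - x j)
        + N * (N - 1) * (N - 2) / 2 * (1 / (Real.pi * r) * (dysonPeriods hN hr ht).etaOne.re) := by
  set e := 1 / (Real.pi * r) * (dysonPeriods hN hr ht).etaOne.re with he
  have hodd (j k : Fin N) := thetaPotential'_sub_comm N r T t (x j) (x k)
  have heven (j k : Fin N) := thetaPotential''_sub_comm N r T t (x j) (x k)
  have hadd (j k l : Fin N) (hjk : j ≠ k) (hkl : k ≠ l) (hlj : l ≠ j) :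
      (thetaPotential' N r T t (x j - x k) + thetaPotential' N r T t (x k - x l)
          + thetaPotential' N r T t (x l - x j)) ^ 2
        = (thetaPotential'' N r T t (x j - x k) - e) + (thetaPotential'' N r T t (x k - x l) - e)
          + (thetaPotential'' N r T t (x l - x j) - e) := by
    have h := thetaPotential'_addition hN hr ht (sub_notMem_lattice hN hr ht hx hjk)
      (sub_notMem_lattice hN hr ht hx hkl)
      (by rw [sub_add_sub_cancel]; exact sub_notMem_lattice hN hr ht hx hlj.symm)
    rw [sub_add_sub_cancel, ← he] at h
    rw [hodd l j, heven l j]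
    linear_combination h
  have hsq (j k : Fin N) :
      thetaPotential' N r T t (x j - x k) ^ 2 = thetaPotential' N r T t (x k - x j) ^ 2 := by
    rw [hodd, neg_sq]
  have hconst : ∑ j : Fin N, ∑ _k ∈ Ioi j, e = N * (N - 1) / 2 * e := by
    rw [← sum_sum_Ioi_one]
    simp only [sum_mul, one_mul]
  have hsum := sum_sq_sum_of_addition hodd (fun j k ↦ by rw [heven]) hadd
  rw [← two_mul_sum_sum_Ioi hsq, ← two_mul_sum_sum_Ioi (fun j k ↦ by rw [heven])] at hsum
  simp only [sum_sub_distrib, hconst, Fintype.card_fin] at hsum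
  rw [hsum]
  ring

lemma sum_coordDeriv_dysonPotential_sq :
    ∑ j, coordDeriv j (dysonPotential r T t) x ^ 2
      = N * ∑ j, ∑ k ∈ Ioi j, thetaPotential' N r T t (x k - x j) ^ 2
        - (N - 2) * ∑ j, ∑ k ∈ Ioi j, thetaPotential'' N r T t (x k - x j)
        + N * (N - 1) * (N - 2) / 2 * (1 / (Real.pi * r) * (dysonPeriods hN hr ht).etaOne.re)
        + N * thetaPotential' N r T t (shiftedSum r x) ^ 2 := by
  have htotal : ∑ j, ∑ k ∈ {j}ᶜ, thetaPotential' N r T t (x j - x k) = 0 := by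
    rw [← sum_sum_Ioi_add_eq_sum_sum_off_diag fun k j ↦ thetaPotential' N r T t (x j - x k)]
    refine sum_eq_zero fun j _ ↦ sum_eq_zero fun k _ ↦ ?_
    rw [thetaPotential'_sub_comm, neg_add_cancel]
  simp only [coordDeriv_dysonPotential hN hr ht hx, add_sq, sum_add_distrib,
    sum_sq_sum_thetaPotential' hN hr ht hx, ← sum_mul, ← mul_sum, htotal, sum_const, card_univ,
    Fintype.card_fin, nsmul_eq_mul]
  ring

include hN hr ht in
lemma sum_coordDeriv_coordDeriv_dysonPotential :
    ∑ j, coordDeriv j (coordDeriv j (dysonPotential r T t)) x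
      = 2 * ∑ j, ∑ k ∈ Ioi j, thetaPotential'' N r T t (x k - x j)
        + N * thetaPotential'' N r T t (shiftedSum r x) := by
  simp only [coordDeriv_coordDeriv_dysonPotential hN hr ht hx, sum_add_distrib]
  rw [← two_mul_sum_sum_Ioi fun j k ↦ thetaPotential''_sub_comm N r T t (x j) (x k), sum_const,
    card_univ, Fintype.card_fin, nsmul_eq_mul]

lemma interaction_sub_groundEnergy (β : ℝ) :
    interaction β r T t x - groundEnergy β hN hr ht
      = β ^ 2 / 8 * ∑ j, coordDeriv j (dysonPotential r T t) x ^ 2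
        - β / 4 * ∑ j, coordDeriv j (coordDeriv j (dysonPotential r T t)) x
        - β / 2 * deriv (fun s ↦ dysonPotential r T s x) t := by
  have hN₀ : (N : ℝ) ≠ 0 := by exact_mod_cast (two_pos.trans_le hN).ne'
  rw [sum_coordDeriv_dysonPotential_sq hN hr ht hx,
    sum_coordDeriv_coordDeriv_dysonPotential hN hr ht hx,
    (hasDerivAt_dysonPotential_time hN hr ht hx).deriv, interaction, groundEnergy]
  field

include hN hr ht in
lemma exp_mul_timeDeriv_conj {β : ℝ} (ht₀ : 0 ≤ t) {g : ℝ → (Fin N → ℝ) → ℝ}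
    (hg : DifferentiableWithinAt ℝ (fun s ↦ g s x) (Set.Ico 0 T) t) :
    Real.exp (β * dysonPotential r T t x / 2)
        * timeDeriv T (fun s y ↦ Real.exp (-β * dysonPotential r T s y / 2) * g s y) t x
      = timeDeriv T g t x - β / 2 * deriv (fun s ↦ dysonPotential r T s x) t * g t x := by
  have hW := (hasDerivAt_dysonPotential_time hN hr ht hx).differentiableAt.hasDerivAt
  rw [timeDeriv, ((((hW.const_mul (-β)).div_const 2).exp.hasDerivWithinAt).fun_mul
    hg.hasDerivWithinAt).derivWithin (uniqueDiffOn_Ico 0 T t ⟨ht₀, ht⟩), timeDeriv]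
  linear_combination (derivWithin (fun s ↦ g s x) (Set.Ico 0 T) t
    - β / 2 * deriv (fun s ↦ dysonPotential r T s x) t * g t x)
      * exp_mul_exp_neg_mul_div_two β (dysonPotential r T t x)

lemma ofReal_interaction (β : ℝ) :
    (interaction β r T t x : ℂ) = (β : ℂ) * (β - 2) / 8 * N *
      (∑ j, ∑ k ∈ Ioi j, ((dysonPeriods hN hr ht).weierstrassZeta ((x k - x j : ℝ) : ℂ)
          - ((x k - x j : ℝ) : ℂ) / (Real.pi * r) * (dysonPeriods hN hr ht).etaOne) ^ 2
        + ((dysonPeriods hN hr ht).weierstrassZeta ((shiftedSum r x : ℝ) : ℂ)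
          - ((shiftedSum r x : ℝ) : ℂ) / (Real.pi * r) * (dysonPeriods hN hr ht).etaOne) ^ 2
        - ((N : ℂ) - 2) / N * ∑ j, ∑ k ∈ Ioi j,
          ((dysonPeriods hN hr ht).weierstrassP ((x k - x j : ℝ) : ℂ)
            + 1 / (Real.pi * r) * (dysonPeriods hN hr ht).etaOne)) := by
  have hsq {y : ℝ} (hy : (y : ℂ) ∉ (dysonPeriods hN hr ht).lattice) :
      ((dysonPeriods hN hr ht).weierstrassZeta y
        - y / (Real.pi * r) * (dysonPeriods hN hr ht).etaOne) ^ 2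
        = (thetaPotential' N r T t y : ℂ) ^ 2 := by
    rw [ofReal_thetaPotential' hN hr ht hy, neg_sq, periodicZeta, two_mul_etaOne_div_ω₁]
    ring
  have hpair {j k : Fin N} (hk : k ∈ Ioi j) :=
    sub_notMem_lattice hN hr ht hx (mem_Ioi.1 hk).ne'
  have hsum : ∑ j, ∑ k ∈ Ioi j, ((dysonPeriods hN hr ht).weierstrassZeta ((x k - x j : ℝ) : ℂ)
        - ((x k - x j : ℝ) : ℂ) / (Real.pi * r) * (dysonPeriods hN hr ht).etaOne) ^ 2
      = ∑ j, ∑ k ∈ Ioi j, (thetaPotential' N r T t (x k - x j) : ℂ) ^ 2 :=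
    sum_congr rfl fun j _ ↦ sum_congr rfl fun k hk ↦ hsq (hpair hk)
  have hsum' : ∑ j, ∑ k ∈ Ioi j, ((dysonPeriods hN hr ht).weierstrassP ((x k - x j : ℝ) : ℂ)
        + 1 / (Real.pi * r) * (dysonPeriods hN hr ht).etaOne)
      = ∑ j, ∑ k ∈ Ioi j, (thetaPotential'' N r T t (x k - x j) : ℂ) :=
    sum_congr rfl fun j _ ↦ sum_congr rfl fun k hk ↦
      (ofReal_thetaPotential'' hN hr ht (hpair hk)).symm
  rw [hsum, hsum', hsq (shiftedSum_notMem_lattice hN hr ht hx), interaction]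
  push_cast
  rfl

end Conjugation

end

theorem lemma3p1 {N : ℕ} (hN : 2 ≤ N) {r T β : ℝ} (hr : 0 < r) (hβ : 0 < β)
    {t : ℝ} (ht : t ∈ Set.Ico 0 T) :
    -- the ground energy, an identity of complex numbers (so that `η₁` is real if `N ≥ 3`)
    ((groundEnergy β hN hr ht.2 : ℝ) : ℂ) =
        -((β : ℂ) ^ 2 / 16) * N * ((N : ℂ) - 1) * ((N : ℂ) - 2) * (1 / ((Real.pi : ℂ) * r))
          * (dysonPeriods hN hr ht.2).etaOne ∧
    ∀ x ∈ regularConfigurations N r,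
      -- the conjugation identity of operators, applied to a function `g` of class `C^{1,2}`
      (∀ g : ℝ → (Fin N → ℝ) → ℝ,
        DifferentiableWithinAt ℝ (fun s => g s x) (Set.Ico 0 T) t →
        ContDiffAt ℝ 2 (g t) x →
        Real.exp (β * dysonPotential r T t x / 2) *
            (timeDeriv T (fun s y => Real.exp (-β * dysonPotential r T s y / 2) * g s y) t x
              - kolmogorovOp β r T t
                  (fun y => Real.exp (-β * dysonPotential r T t y / 2) * g t y) x)
          = timeDeriv T g t x
              + (hamiltonianOp β r T t (g t) x - groundEnergy β hN hr ht.2 * g t x)) ∧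
      -- the expression of the interaction through `ζ`, `℘` and `η₁`
      ((interaction β r T t x : ℝ) : ℂ) =
        (β : ℂ) * (β - 2) / 8 * N *
          (∑ j, ∑ k ∈ Finset.Ioi j,
              ((dysonPeriods hN hr ht.2).weierstrassZeta ((x k - x j : ℝ) : ℂ)
                - ((x k - x j : ℝ) : ℂ) / (Real.pi * r) * (dysonPeriods hN hr ht.2).etaOne) ^ 2
            + ((dysonPeriods hN hr ht.2).weierstrassZeta ((shiftedSum r x : ℝ) : ℂ)
                - ((shiftedSum r x : ℝ) : ℂ) / (Real.pi * r)
                  * (dysonPeriods hN hr ht.2).etaOne) ^ 2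
            - ((N : ℂ) - 2) / N *
              ∑ j, ∑ k ∈ Finset.Ioi j,
                ((dysonPeriods hN hr ht.2).weierstrassP ((x k - x j : ℝ) : ℂ)
                  + 1 / (Real.pi * r) * (dysonPeriods hN hr ht.2).etaOne)) := by
  refine ⟨ofReal_groundEnergy hN hr ht.2 β, fun x hx ↦ ⟨fun g hg hg₂ ↦ ?_,
    ofReal_interaction hN hr ht.2 hx β⟩⟩
  rw [mul_sub, exp_mul_timeDeriv_conj hN hr ht.2 hx ht.1 hg,
    exp_mul_kolmogorovOp_conj hN hr ht.2 hx hg₂, hamiltonianOp]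
  linear_combination -g t x * interaction_sub_groundEnergy hN hr ht.2 hx β
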